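/- Let $M=\mathbb R\times\mathbb R^{+}$ with coordinates $(x_1,x_2)$ and symplectic form $\omega=dx_1\wedge dx_2$; $\omega^{ij}$ denotes the inverse matrix of $\omega_{ij}$, so $\omega_{12}=1$ and $\omega^{12}=-1$. For a smooth $\nu:\mathbb R\to\mathbb R$ put $\mu=x_2\nu(x_1)$ and let $\nabla$ be the connection $$\nabla_{\partial_1}\partial_1=\mu\,\partial_2,\qquad \nabla_{\partial_1}\partial_2=\nabla_{\partial_2}\partial_1=\tfrac1{2x_2}\partial_1,\qquad \nabla_{\partial_2}\partial_2=-\tfrac1{2x_2}\partial_2 .$$ Let $W$ be the Weyl algebra bundle of formal power series in $\hbar,y^1,y^2$ with the fibrewise product $$a\circ b=\exp\!\big(-\tfrac{i\hbar}{2}\,\omega^{jk}\,\partial_{y^j}\partial_{z^k}\big)\,a(y,\hbar)\,b(z,\hbar)\big|_{z=y}.$$ Put $\delta=dx^k\wedge\partial_{y^k}$ and $\delta^*=y^k\,i(\partial_{x^k})$. Fedosov's connection is $D=-\delta+\partial+\frac i\hbar[r,\cdot]$, where $\partial=d+\frac i\hbar[\Gamma,\cdot]$, $\Gamma=\frac12\omega_{im}\Gamma^m_{jk}y^iy^jdx^k$,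 and $r$ is a $W$-valued $1$-form with $\delta r=R+\partial r+\frac i\hbar r\circ r$, $\delta^* r=0$ and $\deg r\ge 3$ ($\deg\hbar=2$, $\deg y^j=1$); here $R=\frac14\omega_{im}R^m_{jkl}y^iy^jdx^k\wedge dx^l$ is the curvature term. For $f\in C^\infty(M)[[\hbar]]$ (complex valued functions) let $\sigma^{-1}(f)$ be the section $a$ with $Da=0$ and $\sigma(a):=a|_{y=0}=f$, and let $f\star g=\sigma(\sigma^{-1}(f)\circ\sigma^{-1}(g))$ be Fedosov's star product. Put $X=\frac1{x_2}\partial_1$, $Y=-x_2\partial_2$, $\Omega=-\frac{\mu}{x_2^3}=-\frac{\nu}{x_2^2}$, $(\alpha)_n=\alpha(\alpha+1)\cdots(\alpha+n-1)$, and define operators on $C^\infty(M)$ by $A_0=B_0=1$, $A_1=-X$, $B_1=X$ and, for $m\ge1$, $$A_{m+1}=-XA_m-m\,\Omega\,\big(Y-\tfrac{m-1}2\big)A_{m-1},\qquad B_{m+1}=XB_m-m\,\Omega\,\big(Y-\tfrac{m-1}2\big)B_{m-1}.$$ Then the following holds. 1. For every $\nu$, the connection $\nabla$ is torsion free, symplectic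 and flat; $r$ exists and is unique; $D^2=0$; and every $f\in C^\infty(M)[[\hbar]]$ has a unique flat lift $\sigma^{-1}(f)=\sum a_{m,n}(y^1)^m(y^2)^n$, with $$a_{m,n}=\frac{(-1)^n x_2^{m-n}}{2^n\,m!\,n!}\,B_m(2Y+m)_n f .$$ 2. For every $\nu$ and all $f,g\in C^\infty(M)[[\hbar]]$, $$f\star g=\sum_{n\ge0}\Big(\frac{i\hbar}{4}\Big)^n\sum_{k=0}^n\Big(\frac{A_k}{k!}(2Y+k)_{n-k}f\Big)\Big(\frac{B_{n-k}}{(n-k)!}(2Y+n-k)_kg\Big).$$ 3. This is Zagier's deformation. For elements $f,g$ of weights $k,l\in\mathbb Z$ of an algebra, a derivation $\vartheta$ of degree $2$ and an element $\Phi$ of weight $4$, let $f_0=f$, $f_{1}=\vartheta f$, $f_{r+1}=\vartheta f_r+r(r+k-1)\Phi f_{r-1}$ for $r\ge1$, similarly $g_r$ with $l$ in place of $k$, and $$[f,g]^{\vartheta,\Phi}_n=\sum_{r+s=n}(-1)^r\binom{n+k-1}{s}\binom{n+l-1}{r}f_rg_s .$$ (a) For every $\nu$ and all $f,g\in C^\infty(M)$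 with $Yf=\frac k2f$ and $Yg=\frac l2g$ one has $f\star g=\sum_n(\frac{i\hbar}4)^n[f,g]_n^{X,\Phi}$ with $\Phi=-\frac12\Omega=\frac{\nu}{2x_2^2}$. (b) Let $F,G$ be modular forms of weights $k,l\in\mathbb Z$ for a subgroup of $GL_2(\mathbb R)$, let $c>0$, and put $\widetilde F(x_1,x_2)=x_2^{-k/2}F(x_1+ic)$, $\widetilde G(x_1,x_2)=x_2^{-l/2}G(x_1+ic)$. For $\nu=0$ one has $$\widetilde F\star\widetilde G=\sum_n\Big(\frac{i\hbar}4\Big)^n\,x_2^{-(k+l+2n)/2}\,RC_n(F,G)(x_1+ic),$$ where $RC_n(F,G)=\sum_{r+s=n}(-1)^r\binom{n+k-1}{s}\binom{n+l-1}{r}F^{(r)}G^{(s)}$ is the Rankin–Cohen bracket. (c) For modular forms $F,G$ of weights $k,l$ for $SL_2(\mathbb Z)$, the Serre derivative $\vartheta F=\frac1{2\pi i}F'-\frac{w}{12}E_2F$ (on forms $F$ of weight $w$) and $\Phi=-\frac1{144}E_4$, one has $[F,G]_n^{\vartheta,\Phi}=(2\pi i)^{-n}RC_n(F,G)$ for all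 $n\ge0$. -/

import Mathlib

open scoped ContDiff MatrixGroups Manifold Nat

noncomputable section

namespace ZagierFedosov

/-! ### The manifold `M = ℝ × ℝ⁺` and its smooth complex functions -/

/-- The half plane `ℝ × ℝ⁺` with coordinates `(x₁, x₂)`, `x₂ > 0`. -/
def M : Set (ℝ × ℝ) := {p | 0 < p.2}

theorem isOpen_M : IsOpen M := isOpen_lt continuous_const continuous_snd

open Classical in
/-- Extension by zero of a function on the open set `M`. -/
def ext (f : M → ℂ) (p : ℝ × ℝ) : ℂ := if h : p ∈ M then f ⟨p, h⟩ else 0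

theorem ext_apply (f : M → ℂ) {p : ℝ × ℝ} (h : p ∈ M) : ext f p = f ⟨p, h⟩ := by
  simp [ext, h]

/-- To see that `f` is smooth it suffices to find a smooth formula for it. -/
theorem contDiffOn_ext {f : M → ℂ} {g : ℝ × ℝ → ℂ} (hg : ContDiffOn ℝ ∞ g M)
    (h : ∀ p : M, f p = g p) : ContDiffOn ℝ ∞ (ext f) M :=
  hg.congr fun p hp => by rw [ext_apply f hp, h ⟨p, hp⟩]

/-- `C^∞(M)`: the algebra of smooth complex valued functions on `M`. -/
def smoothFunctions : Subalgebra ℂ (M → ℂ) where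
  carrier := {f | ContDiffOn ℝ ∞ (ext f) M}
  mul_mem' {f g} hf hg := contDiffOn_ext (hf.mul hg) fun p => by
    simp [ext_apply _ p.2]
  add_mem' {f g} hf hg := contDiffOn_ext (hf.add hg) fun p => by
    simp [ext_apply _ p.2]
  algebraMap_mem' c := contDiffOn_ext (g := fun _ => c) contDiffOn_const fun p => rfl

/-- `C^∞(M)` as a type. -/
abbrev Fn : Type := smoothFunctions

theorem differentiableAt_ext (f : Fn) {p : ℝ × ℝ} (hp : p ∈ M) :
    DifferentiableAt ℝ (ext f.1) p :=
  ((show ContDiffOn ℝ ∞ (ext f.1) M from f.2).contDiffAt (isOpen_M.mem_nhds hp)).differentiableAt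
    (by simp)

/-- The coordinate vectors of `ℝ × ℝ`. -/
def coordVec : Fin 2 → ℝ × ℝ := ![(1, 0), (0, 1)]

theorem ext_add (f g : M → ℂ) : ext (f + g) = ext f + ext g := by
  funext p; by_cases h : p ∈ M <;> simp [ext, h]

theorem ext_smul (c : ℂ) (f : M → ℂ) : ext (c • f) = c • ext f := by
  funext p; by_cases h : p ∈ M <;> simp [ext, h]

/-- The partial derivative `∂/∂x_i` on `C^∞(M)` (index `0` is `x₁`, index `1` is `x₂`). -/
def pd (i : Fin 2) : Module.End ℂ Fn where
  toFun f := ⟨fun p => fderiv ℝ (ext f.1) p (coordVec i),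
    contDiffOn_ext (g := fun p => fderiv ℝ (ext f.1) p (coordVec i))
      (((show ContDiffOn ℝ ∞ (ext f.1) M from f.2).fderiv_of_isOpen isOpen_M
        (m := ∞) (by simp)).clm_apply contDiffOn_const) fun _ => rfl⟩
  map_add' f g := by
    apply Subtype.ext
    funext p
    change fderiv ℝ (ext (f.1 + g.1)) p (coordVec i) = _
    rw [ext_add, fderiv_add (differentiableAt_ext f p.2) (differentiableAt_ext g p.2)]
    rfl
  map_smul' c f := by
    apply Subtype.ext
    funext p
    change fderiv ℝ (ext (c • f.1)) p (coordVec i) = _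
    rw [ext_smul, fderiv_const_smul (differentiableAt_ext f p.2)]
    rfl

/-- The coordinate function `x₂`. -/
def x₂ : Fn := ⟨fun p => (p.1.2 : ℂ),
  contDiffOn_ext (g := fun p => (p.2 : ℂ))
    (Complex.ofRealCLM.contDiff.comp contDiff_snd).contDiffOn fun _ => rfl⟩

/-- The function `1 / x₂`. -/
def x₂inv : Fn := ⟨fun p => ((p.1.2⁻¹ : ℝ) : ℂ),
  contDiffOn_ext (g := fun p => ((p.2⁻¹ : ℝ) : ℂ))
    (Complex.ofRealCLM.contDiff.comp_contDiffOn
      (contDiff_snd.contDiffOn.inv fun _ hp => ne_of_gt hp)) fun _ => rfl⟩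

/-- A smooth function `ν` of `x₁` alone, seen as a function on `M`. -/
def ofX₁ (ν : ℝ → ℝ) (hν : ContDiff ℝ ∞ ν) : Fn := ⟨fun p => (ν p.1.1 : ℂ),
  contDiffOn_ext (g := fun p => (ν p.1 : ℂ))
    (Complex.ofRealCLM.contDiff.comp (hν.comp contDiff_fst)).contDiffOn fun _ => rfl⟩

/-! ### The symplectic form and connections -/

/-- The matrix `ω_ij` of `ω = dx₁ ∧ dx₂`. -/
def ωlow : Matrix (Fin 2) (Fin 2) ℂ := !![0, 1; -1, 0]

/-- The inverse matrix `ω^ij`. -/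
def ωup : Matrix (Fin 2) (Fin 2) ℂ := !![0, -1; 1, 0]

theorem ωup_mul_ωlow : ωup * ωlow = 1 := by
  ext i j; fin_cases i <;> fin_cases j <;> simp [ωup, ωlow, Matrix.mul_apply]

/-- A connection on `TM` through its Christoffel symbols: `∇_{∂_i} ∂_j = ∑ k, Γ k i j • ∂_k`. -/
abbrev Connection : Type := Fin 2 → Fin 2 → Fin 2 → Fn

/-- The torsion vanishes. -/
def IsTorsionFree (Γ : Connection) : Prop := ∀ k i j, Γ k i j = Γ k j i

/-- `∇ω = 0`, that is `∂_k ω_ij = ω(∇_k ∂_i, ∂_j) + ω(∂_i, ∇_k ∂_j)`, with `ω_ij` constant. -/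
def IsSymplectic (Γ : Connection) : Prop :=
  ∀ k i j, ∑ m, (ωlow m j • Γ m k i + ωlow i m • Γ m k j) = 0

/-- `R^m_{j12}`, where `R(∂₁, ∂₂) ∂_j = ∑ m, R^m_{j12} ∂_m` and
`R(U, V) = ∇_U ∇_V - ∇_V ∇_U - ∇_{[U, V]}`. -/
def curvature (Γ : Connection) (m j : Fin 2) : Fn :=
  pd 0 (Γ m 1 j) - pd 1 (Γ m 0 j) + ∑ p, (Γ p 1 j * Γ m 0 p - Γ p 0 j * Γ m 1 p)

/-- The curvature vanishes. -/
def IsFlat (Γ : Connection) : Prop := ∀ m j, curvature Γ m j = 0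

/-- The connection `∇_{∂₁} ∂₁ = μ ∂₂`, `∇_{∂₁} ∂₂ = ∇_{∂₂} ∂₁ = (1 / 2x₂) ∂₁`,
`∇_{∂₂} ∂₂ = -(1 / 2x₂) ∂₂`. -/
def connGen (μ : Fn) : Connection :=
  ![![![0, (1 / 2 : ℂ) • x₂inv], ![(1 / 2 : ℂ) • x₂inv, 0]],
    ![![μ, 0], ![0, -((1 / 2 : ℂ) • x₂inv)]]]

/-- The connection above for `μ = x₂ ν(x₁)`. -/
def zagierConnection (ν : ℝ → ℝ) (hν : ContDiff ℝ ∞ ν) : Connection :=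
  connGen (x₂ * ofX₁ ν hν)

/-! ### The Weyl algebra bundle -/

/-- Formal power series in the fibre coordinates `y¹, y²` over `C^∞(M)`. -/
abbrev FibreSeries : Type := MvPowerSeries (Fin 2) Fn

/-- Smooth sections of the Weyl algebra bundle: formal power series in `ħ, y¹, y²` over `C^∞(M)`.
The power series variable of the outer layer is `ħ`. -/
abbrev Weyl : Type := PowerSeries FibreSeries

/-- `∂/∂yⁱ` on series in `y`. -/
def dy (i : Fin 2) (a : FibreSeries) : FibreSeries := MvPowerSeries.pderiv Fn i a

/-- `∂/∂x_i` on series in `y`, coefficient by coefficient. -/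
def dx (i : Fin 2) (a : FibreSeries) : FibreSeries := fun d => pd i (MvPowerSeries.coeff d a)

/-- `(ω^ij ∂/∂yⁱ ∂/∂zʲ)^k a(y) b(z)` at `z = y`. -/
def bidiff : ℕ → FibreSeries → FibreSeries → FibreSeries
  | 0, a, b => a * b
  | k + 1, a, b => ∑ i, ∑ j, ωup i j • bidiff k (dy i a) (dy j b)

/-- The fibrewise Weyl product `a ∘ b = exp(-(iħ/2) ω^ij ∂/∂yⁱ ∂/∂zʲ) a(y, ħ) b(z, ħ)` at `z = y`:
the coefficient of `ħ^N` collects the terms with `ħ^k` from the exponential, and `ħ^p`, `ħ^q` from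
`a` and `b`, `k + p + q = N`. -/
def weylMul (a b : Weyl) : Weyl :=
  PowerSeries.mk fun N =>
    ∑ kl ∈ Finset.HasAntidiagonal.antidiagonal N, ∑ pq ∈ Finset.HasAntidiagonal.antidiagonal kl.2,
      ((-Complex.I / 2) ^ kl.1 / (kl.1 ! : ℂ)) •
        bidiff kl.1 (PowerSeries.coeff pq.1 a) (PowerSeries.coeff pq.2 b)

/-- Division by `ħ` of a series without constant term in `ħ` (such as a commutator). -/
def divħ (a : Weyl) : Weyl := PowerSeries.mk fun n => PowerSeries.coeff (n + 1) a

/-- `∂/∂yⁱ` on sections of the Weyl bundle. -/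
def dyW (i : Fin 2) (a : Weyl) : Weyl := PowerSeries.mk fun n => dy i (PowerSeries.coeff n a)

/-- `∂/∂x_i` on sections of the Weyl bundle. -/
def dxW (i : Fin 2) (a : Weyl) : Weyl := PowerSeries.mk fun n => dx i (PowerSeries.coeff n a)

/-- The fibre coordinate `yⁱ`. -/
def yW (i : Fin 2) : Weyl := PowerSeries.C (MvPowerSeries.X i)

/-- A function on `M` as a section of the Weyl bundle. -/
def fnW (f : Fn) : Weyl := PowerSeries.C (MvPowerSeries.C f)

/-- Weyl-bundle valued `1`-forms `ρ 0 dx₁ + ρ 1 dx₂`. Weyl-bundle valued `2`-forms `s dx₁ ∧ dx₂`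
are given by their coefficient `s : Weyl`. -/
abbrev WeylForm : Type := Fin 2 → Weyl

/-- The commutator of two sections. -/
def comm (a b : Weyl) : Weyl := weylMul a b - weylMul b a

/-- The product of two `1`-forms (a `2`-form). -/
def formMul (ρ σ : WeylForm) : Weyl := weylMul (ρ 0) (σ 1) - weylMul (ρ 1) (σ 0)

/-- The graded commutator `[ρ, σ] = ρ ∘ σ + σ ∘ ρ` of two `1`-forms. -/
def formComm (ρ σ : WeylForm) : Weyl := formMul ρ σ + formMul σ ρ

theorem coeff_zero_weylMul (a b : Weyl) : PowerSeries.coeff 0 (weylMul a b) =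
    PowerSeries.coeff 0 a * PowerSeries.coeff 0 b := by
  simp [weylMul, bidiff, PowerSeries.coeff_mk]

/-- Commutators are divisible by `ħ`. -/
theorem coeff_zero_comm (a b : Weyl) : PowerSeries.coeff 0 (comm a b) = 0 := by
  rw [comm, map_sub, coeff_zero_weylMul, coeff_zero_weylMul, mul_comm, sub_self]

/-- Graded commutators are divisible by `ħ`. -/
theorem coeff_zero_formComm (ρ σ : WeylForm) : PowerSeries.coeff 0 (formComm ρ σ) = 0 := by
  simp only [formComm, formMul, map_add, map_sub, coeff_zero_weylMul]
  ring

/-- Squares of `1`-forms are divisible by `ħ`. -/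
theorem coeff_zero_formMul_self (ρ : WeylForm) : PowerSeries.coeff 0 (formMul ρ ρ) = 0 := by
  simp only [formMul, map_sub, coeff_zero_weylMul]
  ring

/-- `δ a = dx^k ∧ ∂a/∂y^k` on sections. -/
def δ (a : Weyl) : WeylForm := fun i => dyW i a

/-- `δ ρ = dx^k ∧ ∂ρ/∂y^k` on `1`-forms. -/
def δform (ρ : WeylForm) : Weyl := dyW 0 (ρ 1) - dyW 1 (ρ 0)

/-- `δ* ρ = y^k i(∂/∂x^k) ρ` on `1`-forms. -/
def δstar (ρ : WeylForm) : Weyl := ∑ k, yW k * ρ k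

/-! ### Fedosov's construction -/

/-- `Γ = ½ Γ_ijk yⁱ yʲ dx^k`, where `Γ_ijk = ω_im Γ^m_jk`. -/
def connForm (Γ : Connection) : WeylForm := fun k =>
  (1 / 2 : ℂ) • ∑ i, ∑ j, fnW (∑ m, ωlow i m • Γ m j k) * yW i * yW j

/-- The coefficient of `dx₁ ∧ dx₂` of `R = ¼ R_ijkl yⁱ yʲ dx^k ∧ dx^l`, where
`R_ijkl = ω_im R^m_jkl`. -/
def curvForm (Γ : Connection) : Weyl :=
  (1 / 2 : ℂ) • ∑ i, ∑ j, fnW (∑ m, ωlow i m • curvature Γ m j) * yW i * yW j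

/-- `∂a = da + (i/ħ)[Γ, a]` on sections. -/
def covD (Γ : Connection) (a : Weyl) : WeylForm := fun i =>
  dxW i a + Complex.I • divħ (comm (connForm Γ i) a)

/-- `∂ρ = dρ + (i/ħ)[Γ, ρ]` on `1`-forms. -/
def covDform (Γ : Connection) (ρ : WeylForm) : Weyl :=
  (dxW 0 (ρ 1) - dxW 1 (ρ 0)) + Complex.I • divħ (formComm (connForm Γ) ρ)

/-- `D = -δ + ∂ + (i/ħ)[r, ·]` on sections. -/
def fedosovD (Γ : Connection) (r : WeylForm) (a : Weyl) : WeylForm := fun i =>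
  -δ a i + covD Γ a i + Complex.I • divħ (comm (r i) a)

/-- `D = -δ + ∂ + (i/ħ)[r, ·]` on `1`-forms. -/
def fedosovDform (Γ : Connection) (r : WeylForm) (ρ : WeylForm) : Weyl :=
  -δform ρ + covDform Γ ρ + Complex.I • divħ (formComm r ρ)

/-- Fedosov's conditions on the `1`-form `r` attached to the connection `Γ`: the equation
`δr = R + ∂r + (i/ħ) r ∘ r` (the Weyl curvature of `D` is `-ω`), the normalisation `δ* r = 0`, and
`deg r ≥ 3`, where `deg ħ = 2` and `deg yⁱ = 1`. -/
structure IsFedosovForm (Γ : Connection) (r : WeylForm) : Prop where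
  equation : δform r = curvForm Γ + covDform Γ r + Complex.I • divħ (formMul r r)
  normalised : δstar r = 0
  degree : ∀ (i : Fin 2) (n : ℕ) (d : Fin 2 →₀ ℕ), 2 * n + (d 0 + d 1) < 3 →
    MvPowerSeries.coeff d (PowerSeries.coeff n (r i)) = 0

/-- Fedosov's `1`-form `r`. -/
def fedosovForm (Γ : Connection) : WeylForm := Classical.epsilon (IsFedosovForm Γ)

/-- The projection `σ(a) = a(x, 0, ħ)`. -/
def symbol (a : Weyl) : PowerSeries Fn :=
  PowerSeries.mk fun n => MvPowerSeries.constantCoeff (PowerSeries.coeff n a)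

/-- `a` is the flat section with symbol `f`. -/
def IsFlatLift (Γ : Connection) (f : PowerSeries Fn) (a : Weyl) : Prop :=
  fedosovD Γ (fedosovForm Γ) a = 0 ∧ symbol a = f

/-- `σ⁻¹(f)`: the flat section with symbol `f`. -/
def flatLift (Γ : Connection) (f : PowerSeries Fn) : Weyl := Classical.epsilon (IsFlatLift Γ f)

/-- Fedosov's star product `f ⋆ g = σ(σ⁻¹(f) ∘ σ⁻¹(g))` on `C^∞(M)[[ħ]]`. -/
def fedosovStar (Γ : Connection) (f g : PowerSeries Fn) : PowerSeries Fn :=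
  symbol (weylMul (flatLift Γ f) (flatLift Γ g))

/-- The coefficient `a_{m,n}` of `ħ^N (y¹)^m (y²)^n`. -/
def weylCoeff (a : Weyl) (N m n : ℕ) : Fn :=
  MvPowerSeries.coeff (Finsupp.single 0 m + Finsupp.single 1 n) (PowerSeries.coeff N a)

/-! ### The Rankin–Cohen deformation -/

/-- `X = (1 / x₂) ∂/∂x₁`. -/
def X : Module.End ℂ Fn := LinearMap.mulLeft ℂ x₂inv * pd 0

/-- `Y = -x₂ ∂/∂x₂`. -/
def Y : Module.End ℂ Fn := -(LinearMap.mulLeft ℂ x₂ * pd 1)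

/-- `A₀ = 1`, `A₁ = -X`, `A_{m+1} = -X A_m - m Ω (Y - (m - 1)/2) A_{m-1}`. -/
def rcA (Ω : Fn) : ℕ → Module.End ℂ Fn
  | 0 => 1
  | 1 => -X
  | m + 2 => -(X * rcA Ω (m + 1)) -
      ((m + 1 : ℕ) : ℂ) • (LinearMap.mulLeft ℂ Ω * (Y - ((m : ℂ) / 2) • 1) * rcA Ω m)

/-- `B₀ = 1`, `B₁ = X`, `B_{m+1} = X B_m - m Ω (Y - (m - 1)/2) B_{m-1}`. -/
def rcB (Ω : Fn) : ℕ → Module.End ℂ Fn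
  | 0 => 1
  | 1 => X
  | m + 2 => X * rcB Ω (m + 1) -
      ((m + 1 : ℕ) : ℂ) • (LinearMap.mulLeft ℂ Ω * (Y - ((m : ℂ) / 2) • 1) * rcB Ω m)

/-- `(2Y + k)_n = (2Y + k)(2Y + k + 1) ⋯ (2Y + k + n - 1)`. -/
def poch (k n : ℕ) : Module.End ℂ Fn :=
  Polynomial.aeval ((2 : ℂ) • Y + (k : ℂ) • 1) (ascPochhammer ℂ n)

/-- `RC_n(f, g) = ∑_{k + l = n} (A_k / k!) (2Y + k)_l f · (B_l / l!) (2Y + l)_k g`. -/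
def rcTerm (Ω : Fn) (n : ℕ) (f g : Fn) : Fn :=
  ∑ kl ∈ Finset.HasAntidiagonal.antidiagonal n,
    ((1 / (kl.1 ! : ℂ)) • rcA Ω kl.1 (poch kl.1 kl.2 f)) *
      ((1 / (kl.2 ! : ℂ)) • rcB Ω kl.2 (poch kl.2 kl.1 g))

/-- `∑_n (tħ)^n RC_n(f, g)`, extended `ħ`-bilinearly to formal power series. -/
def rcSeries (Ω : Fn) (t : ℂ) (f g : PowerSeries Fn) : PowerSeries Fn :=
  PowerSeries.mk fun N =>
    ∑ nl ∈ Finset.HasAntidiagonal.antidiagonal N, ∑ pq ∈ Finset.HasAntidiagonal.antidiagonal nl.2,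
      t ^ nl.1 • rcTerm Ω nl.1 (PowerSeries.coeff pq.1 f) (PowerSeries.coeff pq.2 g)

/-! ### Zagier's brackets and modular forms -/

section Zagier

variable {R : Type*} [CommRing R] [Algebra ℂ R]

/-- Zagier's sequence `f₀ = f`, `f_{r+1} = ∂ f_r + r (r + k - 1) Φ f_{r-1}` of an element `f` of
weight `k`; here `Φ` has weight `4`, `f_r` has weight `k + 2r`, and the derivation of degree `2`
acts on elements of weight `w` as `der w`. -/
def zagierSeq (der : ℤ → R → R) (Φ : R) (k : ℤ) (f : R) : ℕ → R
  | 0 => f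
  | 1 => der k f
  | r + 2 => der (k + 2 * (r + 1)) (zagierSeq der Φ k f (r + 1)) +
      (((r + 1) * (r + k) : ℤ) : ℂ) • (Φ * zagierSeq der Φ k f r)

/-- Zagier's bracket of elements of weights `k` and `l`:
`∑_{r + s = n} (-1)^r binom(n + k - 1, s) binom(n + l - 1, r) f_r g_s`. -/
def zagierBracket (der : ℤ → R → R) (Φ : R) (k l : ℤ) (n : ℕ) (f g : R) : R :=
  ∑ rs ∈ Finset.HasAntidiagonal.antidiagonal n,
    (((-1) ^ rs.1 * Ring.choose ((n : ℤ) + k - 1) rs.2 *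
        Ring.choose ((n : ℤ) + l - 1) rs.1 : ℤ) : ℂ) •
      (zagierSeq der Φ k f rs.1 * zagierSeq der Φ l g rs.2)

end Zagier

open UpperHalfPlane in
/-- The derivative `d/dz` of a function on the upper half plane. -/
def ddz (F : ℍ → ℂ) (z : ℍ) : ℂ := deriv (F ∘ ofComplex) z

open UpperHalfPlane in
/-- The Rankin–Cohen bracket
`∑_{r + s = n} (-1)^r binom(n + k - 1, s) binom(n + l - 1, r) f^{(r)} g^{(s)}`. -/
def rankinCohen (k l : ℤ) (n : ℕ) (F G : ℍ → ℂ) : ℍ → ℂ :=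
  ∑ rs ∈ Finset.HasAntidiagonal.antidiagonal n,
    (((-1) ^ rs.1 * Ring.choose ((n : ℤ) + k - 1) rs.2 *
        Ring.choose ((n : ℤ) + l - 1) rs.1 : ℤ) : ℂ) • (ddz^[rs.1] F * ddz^[rs.2] G)

open UpperHalfPlane in
/-- The point `x + i c` of the upper half plane. -/
def horizontal (c : ℝ) (hc : 0 < c) (x : ℝ) : ℍ := ⟨x + c * Complex.I, by simpa using hc⟩

open UpperHalfPlane in
/-- The function `(x₁, x₂) ↦ x₂^(-k/2) F(x₁ + i c)` on `M` attached to a holomorphic function `F` on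
the upper half plane, a weight `k` and a height `c > 0`. -/
def horizontalLift (c : ℝ) (hc : 0 < c) (k : ℤ) (F : ℍ → ℂ) (hF : MDiff F) : Fn :=
  ⟨fun p => ((p.1.2 ^ (-(k : ℝ) / 2) : ℝ) : ℂ) * F (horizontal c hc p.1.1), by
    refine contDiffOn_ext (g := fun p => ((p.2 ^ (-(k : ℝ) / 2) : ℝ) : ℂ) *
      (F ∘ ofComplex) ((p.1 : ℂ) + c * Complex.I)) (ContDiffOn.mul ?_ ?_) ?_
    · exact Complex.ofRealCLM.contDiff.comp_contDiffOn
        (contDiff_snd.contDiffOn.rpow_const_of_ne fun _ hp => ne_of_gt hp)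
    · have h1 : ContDiffOn ℝ ∞ (F ∘ ofComplex) upperHalfPlaneSet :=
        ((UpperHalfPlane.mdifferentiable_iff.mp hF).contDiffOn
          isOpen_upperHalfPlaneSet).restrict_scalars ℝ
      refine h1.comp (t := upperHalfPlaneSet) (s := M)
        (f := fun p : ℝ × ℝ => (p.1 : ℂ) + c * Complex.I) ?_ ?_
      · exact ((Complex.ofRealCLM.contDiff.comp contDiff_fst).add contDiff_const).contDiffOn
      · intro p _
        simpa [upperHalfPlaneSet] using hc
    · intro p
      have h : ofComplex ((p.1.1 : ℂ) + c * Complex.I) = horizontal c hc p.1.1 :=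
        ofComplex_apply_of_im_pos (by simpa using hc)
      simp [h]⟩

end ZagierFedosov

end

open ZagierFedosov UpperHalfPlane

noncomputable section

namespace ZagierFedosov

/-! ### Calculus on `C^∞(M)` -/

/-! Everything rests on the flatness of `∇`. With `R = 0` the form `r = 0` solves Fedosov's
equation. It is the only solution: `δ* r = 0` makes `δ` invertible on `r` with a gain of one degree,
while `∂r` and `r ∘ r / ħ` lose none, so the degree of `r` exceeds every bound
(`IsFedosovForm.eq_zero`). As `Γ` is quadratic in `y`, its commutator is a Poisson bracket, and `D`
acts on each power of `ħ` separately through two commuting first-order operators `flatD` on fibre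
series.

The equations `flatD = 0` are recursions for the coefficients `a_{m,n}` and determine them from
`a_{0,0}` (`eq_zero_of_flatD`). The explicit coefficients solve them because `[Y, X] = X` and `Y Ω =
2 Ω` give `Y B_m = B_m (Y + m)` (`Y_rcB`); see `flatD_zero_flatSeries` and `flatD_one_flatSeries`.
Setting `y = 0` in the binomial expansion of the Weyl product cancels the powers of `x₂` and leaves
the stated series (`cf_bidiff_flatSeries`).

On eigenfunctions of `Y` the Pochhammer operators become numbers, hence binomial coefficients, and
the recursion of `B_m` becomes Zagier's (`rcB_eq_zagierSeq`). For `ν = 0`, `X` differentiates `F`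
along a horizontal line and raises the weight by two.

For the Serre derivative `D + w q` with `q = -E₂ / 12`, Ramanujan's formula for `D E₂` reads `D q =
-(q² + Φ)`. Zagier's sequence is then a combination of the `q^j D^a F`; in generating series this is
multiplication by `exp(q t)`. The sign `(-1)^r` of the bracket pairs it with `exp(-q t)`, so `q`
drops out (`sum_shift_eq`). -/

theorem Fn.ext_iff' {f g : Fn} : f = g ↔ ∀ p : M, f.1 p = g.1 p :=
  Subtype.ext_iff.trans funext_iff

/-- Since `M` is open, the extension by zero agrees near each point of `M` with any formula for `f`,
so derivatives may be computed from that formula. -/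
theorem pd_apply_of_eq (i : Fin 2) (f : Fn) {g : ℝ × ℝ → ℂ} (h : ∀ p : M, f.1 p = g p) (p : M) :
    (pd i f).1 p = fderiv ℝ g p (coordVec i) := by
  change fderiv ℝ (ext f.1) p (coordVec i) = _
  have : ext f.1 =ᶠ[nhds (p : ℝ × ℝ)] g := by
    filter_upwards [isOpen_M.mem_nhds p.2] with q hq
    rw [ext_apply _ hq, h ⟨q, hq⟩]
  rw [this.fderiv_eq]

theorem pd_mul (i : Fin 2) (f g : Fn) : pd i (f * g) = f * pd i g + pd i f * g := by
  rw [Fn.ext_iff']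
  intro p
  rw [pd_apply_of_eq i (f * g) (g := ext f.1 * ext g.1)
    (fun q => by simp [ext_apply _ q.2]), fderiv_mul (differentiableAt_ext f p.2)
    (differentiableAt_ext g p.2)]
  simp [ext_apply _ p.2, pd, mul_comm]

/-- `∂/∂x_i` as a derivation of `C^∞(M)`. -/
def pdDer (i : Fin 2) : Derivation ℂ Fn Fn :=
  Derivation.mk' (pd i) fun f g => by rw [pd_mul, smul_eq_mul, smul_eq_mul, mul_comm (pd i f)]

theorem pd_one (i : Fin 2) : pd i 1 = 0 := (pdDer i).map_one_eq_zero

theorem pd_pow (i : Fin 2) (f : Fn) (n : ℕ) : pd i (f ^ n) = n • (f ^ (n - 1) * pd i f) :=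
  (pdDer i).leibniz_pow f n

theorem pd_comm (f : Fn) : pd 0 (pd 1 f) = pd 1 (pd 0 f) := by
  rw [Fn.ext_iff']
  intro p
  have hf : ContDiffAt ℝ ∞ (ext f.1) p :=
    (show ContDiffOn ℝ ∞ (ext f.1) M from f.2).contDiffAt (isOpen_M.mem_nhds p.2)
  have hd : DifferentiableAt ℝ (fderiv ℝ (ext f.1)) p :=
    (hf.fderiv_right (m := ∞) (by simp)).differentiableAt (by simp)
  have key (i j : Fin 2) : (pd i (pd j f)).1 p =
      fderiv ℝ (fderiv ℝ (ext f.1)) p (coordVec i) (coordVec j) := by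
    rw [pd_apply_of_eq i (pd j f) (g := fun q => fderiv ℝ (ext f.1) q (coordVec j))
      (fun _ => rfl), fderiv_clm_apply hd (by fun_prop)]
    simp
  rw [key, key]
  exact (hf.isSymmSndFDerivAt (by simpa using ENat.LEInfty.out)).eq _ _

theorem pd_zero_x₂ : pd 0 x₂ = 0 := by
  rw [Fn.ext_iff']
  intro p
  rw [pd_apply_of_eq 0 x₂ (g := Complex.ofRealCLM.comp (ContinuousLinearMap.snd ℝ ℝ ℝ))
    (fun _ => rfl), ContinuousLinearMap.fderiv]
  simp [coordVec]

theorem pd_one_x₂ : pd 1 x₂ = 1 := by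
  rw [Fn.ext_iff']
  intro p
  rw [pd_apply_of_eq 1 x₂ (g := Complex.ofRealCLM.comp (ContinuousLinearMap.snd ℝ ℝ ℝ))
    (fun _ => rfl), ContinuousLinearMap.fderiv]
  simp [coordVec]

theorem pd_one_ofX₁ (ν : ℝ → ℝ) (hν : ContDiff ℝ ∞ ν) : pd 1 (ofX₁ ν hν) = 0 := by
  rw [Fn.ext_iff']
  intro p
  have h : DifferentiableAt ℝ (fun x => (ν x : ℂ)) (p : ℝ × ℝ).1 :=
    (Complex.ofRealCLM.contDiff.comp hν).contDiffAt.differentiableAt (by simp)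
  rw [pd_apply_of_eq 1 (ofX₁ ν hν) (g := (fun x => (ν x : ℂ)) ∘ Prod.fst) (fun _ => rfl),
    fderiv_comp _ h differentiableAt_fst, fderiv_fst]
  simp [coordVec]

@[simp] theorem x₂_mul_x₂inv : x₂ * x₂inv = 1 := by
  rw [Fn.ext_iff']
  intro p
  have h : ((p : ℝ × ℝ).2 : ℂ) ≠ 0 := Complex.ofReal_ne_zero.2 (ne_of_gt p.2)
  simp [x₂, x₂inv, h]

theorem pd_zero_x₂inv : pd 0 x₂inv = 0 := by
  have h := congrArg (pd 0) x₂_mul_x₂inv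
  rw [pd_mul, pd_zero_x₂, pd_one] at h
  linear_combination x₂inv * h - pd 0 x₂inv * x₂_mul_x₂inv

theorem pd_one_x₂inv : pd 1 x₂inv = -x₂inv ^ 2 := by
  have h := congrArg (pd 1) x₂_mul_x₂inv
  rw [pd_mul, pd_one_x₂, pd_one] at h
  linear_combination x₂inv * h - pd 1 x₂inv * x₂_mul_x₂inv

/-! ### The operators `X`, `Y`, `A_m`, `B_m` -/

theorem X_apply (f : Fn) : X f = x₂inv * pd 0 f := rfl

theorem Y_apply (f : Fn) : Y f = -(x₂ * pd 1 f) := rfl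

theorem Y_mul (f g : Fn) : Y (f * g) = f * Y g + Y f * g := by
  simp only [Y_apply, pd_mul]
  ring

theorem Y_x₂ : Y x₂ = -x₂ := by simp [Y_apply, pd_one_x₂]

theorem Y_x₂inv : Y x₂inv = x₂inv := by
  rw [Y_apply, pd_one_x₂inv]
  linear_combination x₂inv * x₂_mul_x₂inv

/-- The commutation relation `[Y, X] = X`: the operator `X` raises `Y`-weights by one. All later
weight counts start here. -/
theorem Y_X (f : Fn) : Y (X f) = X (Y f) + X f := by
  simp only [X_apply, Y_mul, Y_x₂inv]
  simp only [Y_apply, map_neg, pd_mul, pd_zero_x₂, pd_comm]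
  ring

theorem Y_x₂_pow (m : ℕ) : Y (x₂ ^ m) = -(m : ℂ) • x₂ ^ m := by
  induction m with
  | zero => simp [Y_apply, pd_one]
  | succ m ih =>
    rw [pow_succ, Y_mul, ih, Y_x₂]
    simp only [Algebra.smul_def, map_neg, map_natCast]
    push_cast
    ring

theorem Y_x₂inv_pow (m : ℕ) : Y (x₂inv ^ m) = (m : ℂ) • x₂inv ^ m := by
  induction m with
  | zero => simp [Y_apply, pd_one]
  | succ m ih =>
    rw [pow_succ, Y_mul, ih, Y_x₂inv]
    simp only [Algebra.smul_def, map_natCast]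
    push_cast
    ring

/-- `Ω = -ν / x₂²` has weight `2` because `ν` does not depend on `x₂`; this is the hypothesis `hΩ`
of the operator identities. -/
theorem Y_ofX₁_mul (ν : ℝ → ℝ) (hν : ContDiff ℝ ∞ ν) :
    Y (-(ofX₁ ν hν * x₂inv ^ 2)) = (2 : ℂ) • -(ofX₁ ν hν * x₂inv ^ 2) := by
  rw [map_neg, Y_mul, Y_x₂inv_pow, Y_apply (ofX₁ ν hν), pd_one_ofX₁]
  simp

theorem rcB_add_two_apply (Ω : Fn) (m : ℕ) (f : Fn) : rcB Ω (m + 2) f =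
    X (rcB Ω (m + 1) f) -
      ((m : ℂ) + 1) • (Ω * (Y (rcB Ω m f) - ((m : ℂ) / 2) • rcB Ω m f)) := by
  simp [rcB]

/-- `Y B_m = B_m (Y + m)` as soon as `Ω` has weight `2` for `Y`. -/
theorem Y_rcB {Ω : Fn} (hΩ : Y Ω = (2 : ℂ) • Ω) (m : ℕ) (f : Fn) :
    Y (rcB Ω m f) = rcB Ω m (Y f) + (m : ℂ) • rcB Ω m f := by
  induction m using Nat.twoStepInduction generalizing f with
  | zero => simp [rcB]
  | one => simp [rcB, Y_X]
  | more m h0 h1 =>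
    rw [rcB_add_two_apply, rcB_add_two_apply]
    simp only [map_sub, map_smul, Y_X, Y_mul, h0, h1, hΩ, map_add]
    simp only [Algebra.smul_def, map_natCast, map_add, map_one, map_ofNat]
    push_cast
    ring

/-- The two recursions differ by `X ↦ -X`, and the `Ω`-term goes back two indices, which respects
the parity sign. Only `B_m` needs to be studied. -/
theorem rcA_apply (Ω : Fn) (m : ℕ) (f : Fn) : rcA Ω m f = (-1 : ℂ) ^ m • rcB Ω m f := by
  induction m using Nat.twoStepInduction with
  | zero => simp [rcA, rcB]
  | one => simp [rcA, rcB]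
  | more m h0 h1 =>
    simp only [rcA, rcB, LinearMap.sub_apply, LinearMap.neg_apply, LinearMap.smul_apply,
      Module.End.mul_apply, h0, h1, map_smul, pow_succ]
    module

theorem poch_zero (k : ℕ) : poch k 0 = 1 := by simp [poch]

theorem poch_succ_apply (k n : ℕ) (f : Fn) :
    poch k (n + 1) f = (2 : ℂ) • Y (poch k n f) + ((k : ℂ) + n) • poch k n f := by
  have h : poch k (n + 1) = ((2 : ℂ) • Y + ((k : ℂ) + n) • 1) * poch k n := by
    rw [poch, ascPochhammer_succ_right, mul_comm, map_mul, poch]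
    simp only [map_add, Polynomial.aeval_X, map_natCast]
    congr 1
    rw [add_smul, add_assoc, Nat.cast_smul_eq_nsmul ℂ n, nsmul_one]
  rw [h]
  simp [Module.End.mul_apply]

theorem poch_succ_apply' (k n : ℕ) (f : Fn) :
    poch k (n + 1) f = (2 : ℂ) • Y (poch (k + 1) n f) + (k : ℂ) • poch (k + 1) n f := by
  have h : poch k (n + 1) = ((2 : ℂ) • Y + (k : ℂ) • 1) * poch (k + 1) n := by
    rw [poch, ascPochhammer_succ_left, map_mul, Polynomial.aeval_X, poch, Polynomial.aeval_comp]
    simp only [map_add, Polynomial.aeval_X, map_one]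
    congr 3
    push_cast
    rw [add_smul, one_smul, add_assoc]
  rw [h]
  simp [Module.End.mul_apply]

/-- Both Pochhammer products of length `n + 1` contain `(2Y + m + 1)_n`; the remaining factors `2Y +
m + n + 1` and `2Y + m` differ by `n + 1`. -/
theorem poch_sub (m n : ℕ) (f : Fn) :
    poch (m + 1) (n + 1) f = poch m (n + 1) f + ((n : ℂ) + 1) • poch (m + 1) n f := by
  rw [poch_succ_apply, poch_succ_apply']
  push_cast
  module

/-! ### Series in the fibre coordinates -/

/-- The coefficient of `(y¹)^m (y²)^n`. -/
def cf (m n : ℕ) : FibreSeries →ₗ[Fn] Fn :=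
  MvPowerSeries.coeff (Finsupp.single 0 m + Finsupp.single 1 n)

theorem finsupp_fin_two_eq (d : Fin 2 →₀ ℕ) :
    Finsupp.single 0 (d 0) + Finsupp.single 1 (d 1) = d := by
  ext i
  fin_cases i <;> simp

theorem coeff_eq_cf (d : Fin 2 →₀ ℕ) (a : FibreSeries) :
    MvPowerSeries.coeff d a = cf (d 0) (d 1) a := by
  rw [cf, finsupp_fin_two_eq]

theorem fibre_ext {a b : FibreSeries} (h : ∀ m n, cf m n a = cf m n b) : a = b := by
  ext1 d
  rw [coeff_eq_cf, coeff_eq_cf, h]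

theorem cf_smul (m n : ℕ) (c : ℂ) (a : FibreSeries) : cf m n (c • a) = c • cf m n a := rfl

theorem cf_zero_zero (a : FibreSeries) : cf 0 0 a = MvPowerSeries.constantCoeff a := by
  simp [cf]

theorem cf_C_mul (m n : ℕ) (f : Fn) (a : FibreSeries) :
    cf m n (MvPowerSeries.C f * a) = f * cf m n a :=
  MvPowerSeries.coeff_C_mul _ _ _

theorem cf_X_zero_mul (m n : ℕ) (a : FibreSeries) :
    cf m n (MvPowerSeries.X 0 * a) = if m = 0 then 0 else cf (m - 1) n a := by
  rw [cf, MvPowerSeries.X, MvPowerSeries.coeff_monomial_mul]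
  rcases m with - | m
  · rw [if_neg (fun h => by simpa using h 0)]; simp
  · rw [if_pos (Finsupp.le_def.2 fun i => by fin_cases i <;> simp), cf]
    simp only [Nat.add_eq_zero_iff, one_ne_zero, and_false, if_false, one_mul]
    congr 2
    ext i
    fin_cases i <;> simp

theorem cf_X_one_mul (m n : ℕ) (a : FibreSeries) :
    cf m n (MvPowerSeries.X 1 * a) = if n = 0 then 0 else cf m (n - 1) a := by
  rw [cf, MvPowerSeries.X, MvPowerSeries.coeff_monomial_mul]
  rcases n with - | n
  · rw [if_neg (fun h => by simpa using h 1)]; simp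
  · rw [if_pos (Finsupp.le_def.2 fun i => by fin_cases i <;> simp), cf]
    simp only [Nat.add_eq_zero_iff, one_ne_zero, and_false, if_false, one_mul]
    congr 2
    ext i
    fin_cases i <;> simp

theorem cf_dy_zero (m n : ℕ) (a : FibreSeries) :
    cf m n (dy 0 a) = ((m : ℂ) + 1) • cf (m + 1) n a := by
  rw [cf, dy, MvPowerSeries.coeff_pderiv, cf, Finsupp.single_add, add_right_comm, mul_comm,
    Algebra.smul_def]
  simp

theorem cf_dy_one (m n : ℕ) (a : FibreSeries) :
    cf m n (dy 1 a) = ((n : ℂ) + 1) • cf m (n + 1) a := by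
  rw [cf, dy, MvPowerSeries.coeff_pderiv, cf, Finsupp.single_add, add_assoc, mul_comm,
    Algebra.smul_def]
  simp

theorem cf_dx (m n : ℕ) (i : Fin 2) (a : FibreSeries) : cf m n (dx i a) = pd i (cf m n a) := rfl

@[simp] theorem dy_zero (i : Fin 2) : dy i 0 = 0 := map_zero _

theorem dy_add (i : Fin 2) (a b : FibreSeries) : dy i (a + b) = dy i a + dy i b := map_add _ _ _

theorem dy_neg (i : Fin 2) (a : FibreSeries) : dy i (-a) = -dy i a := map_neg _ _

theorem dy_sub (i : Fin 2) (a b : FibreSeries) : dy i (a - b) = dy i a - dy i b := map_sub _ _ _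

theorem dy_mul (i : Fin 2) (a b : FibreSeries) : dy i (a * b) = a * dy i b + b * dy i a :=
  (MvPowerSeries.pderiv Fn i).leibniz a b

theorem dy_C (i : Fin 2) (f : Fn) : dy i (MvPowerSeries.C f) = 0 := MvPowerSeries.pderiv_C

theorem dy_X (i j : Fin 2) : dy i (MvPowerSeries.X j) = if i = j then 1 else 0 := by
  split_ifs with h
  · rw [h]; exact MvPowerSeries.pderiv_X_self
  · exact MvPowerSeries.pderiv_X_of_ne (Ne.symm h)

theorem dy_comm (i j : Fin 2) (a : FibreSeries) : dy i (dy j a) = dy j (dy i a) := by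
  rcases eq_or_ne i j with rfl | h
  · rfl
  · ext1 d
    simp only [dy, MvPowerSeries.coeff_pderiv, Finsupp.add_apply,
      Finsupp.single_eq_of_ne h, Finsupp.single_eq_of_ne h.symm, add_zero]
    rw [add_right_comm]
    ring

@[simp] theorem dx_zero (i : Fin 2) : dx i 0 = 0 := by
  ext1 d; exact map_zero (pd i)

theorem dx_add (i : Fin 2) (a b : FibreSeries) : dx i (a + b) = dx i a + dx i b := by
  ext1 d; exact map_add (pd i) _ _

theorem dx_neg (i : Fin 2) (a : FibreSeries) : dx i (-a) = -dx i a := by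
  ext1 d; exact map_neg (pd i) _

theorem dx_sub (i : Fin 2) (a b : FibreSeries) : dx i (a - b) = dx i a - dx i b := by
  ext1 d; exact map_sub (pd i) _ _

theorem dx_mul (i : Fin 2) (a b : FibreSeries) : dx i (a * b) = a * dx i b + dx i a * b := by
  classical
  ext1 d
  change pd i (MvPowerSeries.coeff d (a * b)) = _
  rw [map_add, MvPowerSeries.coeff_mul, MvPowerSeries.coeff_mul, MvPowerSeries.coeff_mul, map_sum,
    ← Finset.sum_add_distrib]
  exact Finset.sum_congr rfl fun p _ => pd_mul i _ _

theorem dx_C (i : Fin 2) (f : Fn) : dx i (MvPowerSeries.C f) = MvPowerSeries.C (pd i f) := by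
  classical
  ext1 d
  change pd i (MvPowerSeries.coeff d (MvPowerSeries.C f)) = _
  rw [MvPowerSeries.coeff_C, MvPowerSeries.coeff_C]
  split_ifs <;> simp

theorem dx_X (i j : Fin 2) : dx i (MvPowerSeries.X j) = 0 := by
  classical
  ext1 d
  change pd i (MvPowerSeries.coeff d (MvPowerSeries.X j)) = _
  rw [MvPowerSeries.coeff_X]
  split_ifs <;> simp [pd_one]

theorem dx_comm (a : FibreSeries) : dx 0 (dx 1 a) = dx 1 (dx 0 a) := by
  ext1 d; exact pd_comm _

theorem dy_dx (i j : Fin 2) (a : FibreSeries) : dy i (dx j a) = dx j (dy i a) := by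
  ext1 d
  change _ = pd j (MvPowerSeries.coeff d (dy i a))
  rw [dy, dy, MvPowerSeries.coeff_pderiv, MvPowerSeries.coeff_pderiv,
    ← Nat.cast_add_one, mul_comm, mul_comm _ ((_ : ℕ) : Fn), ← nsmul_eq_mul, ← nsmul_eq_mul,
    map_nsmul]
  rfl

/-! ### The Weyl product -/

theorem bidiff_succ (k : ℕ) (a b : FibreSeries) :
    bidiff (k + 1) a b = bidiff k (dy 1 a) (dy 0 b) - bidiff k (dy 0 a) (dy 1 b) := by
  simp [bidiff, ωup, neg_add_eq_sub]

theorem bidiff_zero_left (k : ℕ) (b : FibreSeries) : bidiff k 0 b = 0 := by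
  induction k generalizing b with
  | zero => simp [bidiff]
  | succ k ih => simp [bidiff_succ, ih]

theorem bidiff_zero_right (k : ℕ) (a : FibreSeries) : bidiff k a 0 = 0 := by
  induction k generalizing a with
  | zero => simp [bidiff]
  | succ k ih => simp [bidiff_succ, ih]

theorem FibreSeries.neg_smul (c : ℂ) (a : FibreSeries) : (-c) • a = -(c • a) :=
  _root_.neg_smul c a

/-- `ω^{ij}` is antisymmetric, so each application contributes one sign. Hence a commutator retains
only the odd orders `k`, with a factor `2`. -/
theorem bidiff_symm (k : ℕ) (a b : FibreSeries) : bidiff k b a = (-1 : ℂ) ^ k • bidiff k a b := by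
  induction k generalizing a b with
  | zero => simp [bidiff, mul_comm]
  | succ k ih =>
    rw [bidiff_succ, bidiff_succ, ih (dy 0 a), ih (dy 1 a), pow_succ, mul_neg_one, FibreSeries.neg_smul,
      smul_sub, neg_sub]

theorem bidiff_eq_zero_of_quadratic {q : FibreSeries}
    (hq : ∀ i j k, dy i (dy j (dy k q)) = 0) (k : ℕ) (a : FibreSeries) :
    bidiff (k + 3) q a = 0 := by
  simp [bidiff_succ, hq, bidiff_zero_left]

/-- The binomial theorem for the commuting operators `∂₂ ⊗ ∂₁` and `-∂₁ ⊗ ∂₂`. -/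
theorem bidiff_eq_sum (k : ℕ) (a b : FibreSeries) :
    bidiff k a b = ∑ jl ∈ Finset.HasAntidiagonal.antidiagonal k, k.choose jl.1 •
      ((-1 : ℂ) ^ jl.2 • ((dy 1)^[jl.1] ((dy 0)^[jl.2] a) * (dy 0)^[jl.1] ((dy 1)^[jl.2] b))) := by
  induction k generalizing a b with
  | zero => simp [bidiff]
  | succ k ih =>
    have hc (i j : Fin 2) (n : ℕ) (c : FibreSeries) : (dy i)^[n] (dy j c) = dy j ((dy i)^[n] c) :=
      (Function.Commute.iterate_left (fun x => dy_comm i j x) n) c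
    rw [Finset.sum_antidiagonal_choose_succ_nsmul (fun j l => (-1 : ℂ) ^ l •
      ((dy 1)^[j] ((dy 0)^[l] a) * (dy 0)^[j] ((dy 1)^[l] b))), bidiff_succ, ih, ih, add_comm,
      sub_eq_add_neg, ← Finset.sum_neg_distrib]
    congr 1
    · refine Finset.sum_congr rfl fun jl hjl => ?_
      rw [← Nat.choose_symm_of_eq_add (Finset.HasAntidiagonal.mem_antidiagonal.1 hjl).symm]
      simp only [Function.iterate_succ_apply, hc]
    · refine Finset.sum_congr rfl fun jl _ => ?_
      simp only [Function.iterate_succ_apply, hc, pow_succ]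
      rw [mul_neg_one, FibreSeries.neg_smul, smul_neg]

/-- The `ħ`-coefficients of the Weyl product with a section constant in `ħ`. -/
theorem coeff_weylMul_C_left (q : FibreSeries) (a : Weyl) (N : ℕ) :
    PowerSeries.coeff N (weylMul (PowerSeries.C q) a) =
      ∑ kl ∈ Finset.HasAntidiagonal.antidiagonal N, ((-Complex.I / 2) ^ kl.1 / (kl.1 ! : ℂ)) •
        bidiff kl.1 q (PowerSeries.coeff kl.2 a) := by
  rw [weylMul, PowerSeries.coeff_mk]
  refine Finset.sum_congr rfl fun kl _ => ?_
  rw [Finset.sum_eq_single (0, kl.2)]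
  · simp
  · rintro ⟨p, q⟩ h1 h2
    have : p ≠ 0 := by rintro rfl; simp_all
    simp [PowerSeries.coeff_C, this, bidiff_zero_left]
  · simp

theorem coeff_weylMul_C_right (q : FibreSeries) (a : Weyl) (N : ℕ) :
    PowerSeries.coeff N (weylMul a (PowerSeries.C q)) =
      ∑ kl ∈ Finset.HasAntidiagonal.antidiagonal N, ((-Complex.I / 2) ^ kl.1 / (kl.1 ! : ℂ)) •
        bidiff kl.1 (PowerSeries.coeff kl.2 a) q := by
  rw [weylMul, PowerSeries.coeff_mk]
  refine Finset.sum_congr rfl fun kl _ => ?_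
  rw [Finset.sum_eq_single (kl.2, 0)]
  · simp
  · rintro ⟨p, q⟩ h1 h2
    have : q ≠ 0 := by rintro rfl; simp_all
    simp [PowerSeries.coeff_C, this, bidiff_zero_right]
  · simp

/-- The commutator with a quadratic polynomial is given by the Poisson bracket. -/
theorem coeff_divħ_comm_quadratic {q : FibreSeries} (hq : ∀ i j k, dy i (dy j (dy k q)) = 0)
    (a : Weyl) (N : ℕ) : Complex.I • PowerSeries.coeff N (divħ (comm (PowerSeries.C q) a)) =
      dy 1 q * dy 0 (PowerSeries.coeff N a) - dy 0 q * dy 1 (PowerSeries.coeff N a) := by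
  rw [divħ, PowerSeries.coeff_mk, comm, map_sub, coeff_weylMul_C_left, coeff_weylMul_C_right,
    ← Finset.sum_sub_distrib, Finset.sum_eq_single (1, N)]
  · rw [bidiff_symm 1 q, bidiff_succ, bidiff, bidiff]
    simp only [pow_one, Nat.factorial_one, Nat.cast_one, div_one,
      FibreSeries.neg_smul, one_smul, smul_neg,
      sub_neg_eq_add, ← two_smul ℂ, smul_smul]
    rw [show Complex.I * (2 * (-Complex.I / 2)) = 1 by linear_combination -Complex.I_mul_I,
      one_smul]
  -- Orders `0` and `2` cancel by symmetry and orders `≥ 3` kill a quadratic `q`. Order `1` occurs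
  -- only as `(1, N)`, since `divħ` shifts the index to `N + 1`.
  · rintro ⟨k, l⟩ h1 h2
    rw [bidiff_symm k q]
    rcases k with - | - | - | k
    · simp
    · simp_all
      omega
    · simp
    · simp [bidiff_eq_zero_of_quadratic hq]
  · simp [add_comm]

theorem weylMul_zero_left (a : Weyl) : weylMul 0 a = 0 := by
  ext1 N
  simp [weylMul, bidiff_zero_left]

theorem weylMul_zero_right (a : Weyl) : weylMul a 0 = 0 := by
  ext1 N
  simp [weylMul, bidiff_zero_right]

/-! ### The degree filtration -/

/-- All terms of `a` have degree at least `p` in `y`. -/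
def OrderGE (p : ℕ) (a : FibreSeries) : Prop := ∀ m n, m + n < p → cf m n a = 0

theorem OrderGE.dy {p : ℕ} {a : FibreSeries} (h : OrderGE p a) (i : Fin 2) :
    OrderGE (p - 1) (dy i a) := by
  intro m n hmn
  fin_cases i
  · change cf m n (ZagierFedosov.dy 0 a) = 0
    rw [cf_dy_zero, h _ _ (by omega), smul_zero]
  · change cf m n (ZagierFedosov.dy 1 a) = 0
    rw [cf_dy_one, h _ _ (by omega), smul_zero]

theorem OrderGE.mul {p q : ℕ} {a b : FibreSeries} (ha : OrderGE p a) (hb : OrderGE q b) :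
    OrderGE (p + q) (a * b) := by
  classical
  intro m n hmn
  rw [cf, MvPowerSeries.coeff_mul]
  refine Finset.sum_eq_zero fun d hd => ?_
  have hd := Finset.HasAntidiagonal.mem_antidiagonal.1 hd
  have h0 := DFunLike.congr_fun hd 0
  have h1 := DFunLike.congr_fun hd 1
  simp at h0 h1
  rw [coeff_eq_cf, coeff_eq_cf]
  rcases lt_or_ge (d.1 0 + d.1 1) p with h | h
  · rw [ha _ _ h, zero_mul]
  · rw [hb _ _ (by omega), mul_zero]

theorem OrderGE.bidiff {p q : ℕ} {a b : FibreSeries} (ha : OrderGE p a) (hb : OrderGE q b)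
    (k : ℕ) : OrderGE (p + q - 2 * k) (bidiff k a b) := by
  induction k generalizing p q a b with
  | zero => exact ha.mul hb
  | succ k ih =>
    intro m n hmn
    rw [bidiff_succ, map_sub, ih (ha.dy 1) (hb.dy 0) m n (by omega),
      ih (ha.dy 0) (hb.dy 1) m n (by omega), sub_zero]

/-- All terms of `a` have degree at least `p`, where `deg ħ = 2` and `deg yⁱ = 1`. -/
def DegreeGE (p : ℕ) (a : Weyl) : Prop := ∀ N, OrderGE (p - 2 * N) (PowerSeries.coeff N a)

/-- Each factor `ħ` of the exponential adds degree two and comes with two `y`-derivatives, which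
remove two; the Weyl product is therefore graded. -/
theorem DegreeGE.weylMul {p q : ℕ} {a b : Weyl} (ha : DegreeGE p a) (hb : DegreeGE q b) :
    DegreeGE (p + q) (weylMul a b) := by
  intro N m n hmn
  rw [ZagierFedosov.weylMul, PowerSeries.coeff_mk, map_sum]
  refine Finset.sum_eq_zero fun kl h1 => ?_
  rw [map_sum]
  refine Finset.sum_eq_zero fun pq h2 => ?_
  have h1 := Finset.HasAntidiagonal.mem_antidiagonal.1 h1
  have h2 := Finset.HasAntidiagonal.mem_antidiagonal.1 h2
  rw [cf_smul, (ha pq.1).bidiff (hb pq.2) kl.1 m n (by omega), smul_zero]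

/-! ### The connection and its flatness -/

theorem smul_half_eq (f : Fn) : f = (1 / 2 : ℂ) • f + (1 / 2 : ℂ) • f := by module

section Connection

variable (ν : ℝ → ℝ) (hν : ContDiff ℝ ∞ ν)

theorem isTorsionFree_zagierConnection : IsTorsionFree (zagierConnection ν hν) := by
  intro k i j
  fin_cases k <;> fin_cases i <;> fin_cases j <;> rfl

theorem isSymplectic_zagierConnection : IsSymplectic (zagierConnection ν hν) := by
  intro k i j
  fin_cases k <;> fin_cases i <;> fin_cases j <;> simp [zagierConnection, connGen, ωlow]

/-- The component `m = 1, j = 0` equals `μ / x₂ - ∂₂ μ`, which vanishes because `μ` is linear in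
`x₂`. The other components do not involve `μ`. -/
theorem isFlat_zagierConnection : IsFlat (zagierConnection ν hν) := by
  have e : x₂ * x₂inv = 1 := x₂_mul_x₂inv
  -- Scalars enter the ring identities as opaque elements of `Fn`; this relation is all that is
  -- needed about the constant `1 / 2`.
  have ht : 2 * algebraMap ℂ Fn (1 / 2) = 1 := by
    rw [← map_ofNat (algebraMap ℂ Fn) 2, ← map_mul]; norm_num
  intro m j
  fin_cases m <;> fin_cases j <;>
    simp [-one_div, curvature, zagierConnection, connGen, pd_zero_x₂inv, pd_one_x₂inv, pd_mul,
      pd_one_x₂, pd_one_ofX₁] <;>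
    simp only [Algebra.smul_def]
  · linear_combination -(algebraMap ℂ Fn (1 / 2) * x₂inv ^ 2) * ht
  · linear_combination (2 * algebraMap ℂ Fn (1 / 2) * ofX₁ ν hν) * e + ofX₁ ν hν * ht

/-- The quadratic series `Γ_k = ½ Γ_ijk yⁱ yʲ`. -/
def connSeries (k : Fin 2) : FibreSeries :=
  ![MvPowerSeries.C ((1 / 2 : ℂ) • (x₂ * ofX₁ ν hν)) * MvPowerSeries.X 0 ^ 2 -
      MvPowerSeries.C ((1 / 4 : ℂ) • x₂inv) * MvPowerSeries.X 1 ^ 2,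
    -(MvPowerSeries.C ((1 / 2 : ℂ) • x₂inv) * MvPowerSeries.X 0 * MvPowerSeries.X 1)] k

theorem connForm_zagierConnection (k : Fin 2) :
    connForm (zagierConnection ν hν) k = PowerSeries.C (connSeries ν hν k) := by
  have hs (c : ℂ) (a : Weyl) :
      c • a = PowerSeries.C (MvPowerSeries.C (algebraMap ℂ Fn c)) * a := by
    ext1 n
    rw [PowerSeries.coeff_C_mul]
    ext1 d
    rw [MvPowerSeries.coeff_C_mul, ← Algebra.smul_def]
    rfl
  have ht : algebraMap ℂ Fn (1 / 2) + algebraMap ℂ Fn (1 / 2) = 1 := by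
    rw [← map_add]; norm_num
  have h4 : (1 / 4 : ℂ) = 1 / 2 * (1 / 2) := by norm_num
  have ht' := congrArg (fun f : Fn => (PowerSeries.C (MvPowerSeries.C f) : Weyl)) ht
  simp only [map_add, map_one] at ht'
  fin_cases k
  · simp [-one_div, connForm, zagierConnection, connGen, ωlow, fnW, yW, connSeries, hs]
    simp only [Algebra.smul_def, map_mul, h4]
    ring
  · simp [-one_div, connForm, zagierConnection, connGen, ωlow, fnW, yW, connSeries, hs]
    simp only [Algebra.smul_def, map_mul]
    set t : Weyl := PowerSeries.C (MvPowerSeries.C (algebraMap ℂ Fn (1 / 2)))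
    linear_combination -(t * PowerSeries.C (MvPowerSeries.C x₂inv) *
      PowerSeries.C (MvPowerSeries.X 0) * PowerSeries.C (MvPowerSeries.X 1)) * ht'

end Connection

/-! ### Order estimates -/

theorem OrderGE.mono {p q : ℕ} {a : FibreSeries} (h : OrderGE q a) (hpq : p ≤ q) : OrderGE p a :=
  fun m n hmn => h m n (hmn.trans_le hpq)

theorem OrderGE.add {p : ℕ} {a b : FibreSeries} (ha : OrderGE p a) (hb : OrderGE p b) :
    OrderGE p (a + b) := fun m n h => by rw [map_add, ha m n h, hb m n h, add_zero]

theorem OrderGE.neg {p : ℕ} {a : FibreSeries} (ha : OrderGE p a) : OrderGE p (-a) :=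
  fun m n h => by rw [map_neg, ha m n h, neg_zero]

theorem OrderGE.sub {p : ℕ} {a b : FibreSeries} (ha : OrderGE p a) (hb : OrderGE p b) :
    OrderGE p (a - b) := sub_eq_add_neg a b ▸ ha.add hb.neg

theorem OrderGE.smul {p : ℕ} {a : FibreSeries} (ha : OrderGE p a) (c : ℂ) : OrderGE p (c • a) :=
  fun m n h => by rw [cf_smul, ha m n h, smul_zero]

theorem OrderGE.dx {p : ℕ} {a : FibreSeries} (ha : OrderGE p a) (i : Fin 2) :
    OrderGE p (dx i a) := fun m n h => by rw [cf_dx, ha m n h, map_zero]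

theorem orderGE_zero (a : FibreSeries) : OrderGE 0 a := fun m n h => absurd h (by omega)

theorem orderGE_X (i : Fin 2) : OrderGE 1 (MvPowerSeries.X i) := by
  intro m n h
  obtain rfl : m = 0 := by omega
  obtain rfl : n = 0 := by omega
  rw [cf_zero_zero, MvPowerSeries.constantCoeff_X]

/-- The Poisson bracket with a quadratic series does not lower the order. -/
theorem OrderGE.poisson {p : ℕ} {q a : FibreSeries} (hq : OrderGE 2 q) (ha : OrderGE p a) :
    OrderGE p (ZagierFedosov.dy 1 q * ZagierFedosov.dy 0 a -
      ZagierFedosov.dy 0 q * ZagierFedosov.dy 1 a) :=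
  (((hq.dy 1).mul (ha.dy 0)).mono (by omega)).sub (((hq.dy 0).mul (ha.dy 1)).mono (by omega))

theorem dy_one (i : Fin 2) : dy i 1 = 0 := MvPowerSeries.pderiv_one

/-! ### Vanishing of Fedosov's form and `D² = 0` -/

section Connection

variable (ν : ℝ → ℝ) (hν : ContDiff ℝ ∞ ν)

theorem dy_dy_dy_connSeries (l i j k : Fin 2) :
    dy i (dy j (dy k (connSeries ν hν l))) = 0 := by
  fin_cases l <;> fin_cases i <;> fin_cases j <;> fin_cases k <;>
    simp [connSeries, pow_two, dy_sub, dy_neg, dy_add, dy_mul, dy_C, dy_X, dy_one, mul_assoc]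

theorem orderGE_connSeries (k : Fin 2) : OrderGE 2 (connSeries ν hν k) := by
  fin_cases k
  · have h (f : Fn) (i : Fin 2) : OrderGE 2 (MvPowerSeries.C f * MvPowerSeries.X i ^ 2) := by
      rw [pow_two]
      exact (orderGE_zero _).mul ((orderGE_X i).mul (orderGE_X i))
    exact (h _ _).sub (h _ _)
  · exact (((orderGE_zero _).mul (orderGE_X 0)).mul (orderGE_X 1)).neg

/-- `-δ + ∂` on series in the fibre coordinates. -/
def flatD (i : Fin 2) (a : FibreSeries) : FibreSeries :=
  -dy i a + dx i a + (dy 1 (connSeries ν hν i) * dy 0 a - dy 0 (connSeries ν hν i) * dy 1 a)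

theorem coeff_covD (a : Weyl) (i : Fin 2) (N : ℕ) :
    PowerSeries.coeff N (covD (zagierConnection ν hν) a i) = dx i (PowerSeries.coeff N a) +
      (dy 1 (connSeries ν hν i) * dy 0 (PowerSeries.coeff N a) -
        dy 0 (connSeries ν hν i) * dy 1 (PowerSeries.coeff N a)) := by
  rw [← coeff_divħ_comm_quadratic (dy_dy_dy_connSeries ν hν i) a N,
    ← connForm_zagierConnection, covD, map_add, dxW, PowerSeries.coeff_mk]
  rfl

theorem formComm_eq (ρ σ : WeylForm) :
    formComm ρ σ = comm (ρ 0) (σ 1) - comm (ρ 1) (σ 0) := by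
  simp only [formComm, formMul, comm]
  ring

theorem coeff_covDform (ρ : WeylForm) (N : ℕ) :
    PowerSeries.coeff N (covDform (zagierConnection ν hν) ρ) =
      PowerSeries.coeff N (covD (zagierConnection ν hν) (ρ 1) 0) -
      PowerSeries.coeff N (covD (zagierConnection ν hν) (ρ 0) 1) := by
  have : covDform (zagierConnection ν hν) ρ =
      covD (zagierConnection ν hν) (ρ 1) 0 - covD (zagierConnection ν hν) (ρ 0) 1 := by
    rw [covDform, covD, covD, formComm_eq, show ∀ a b : Weyl, divħ (a - b) = divħ a - divħ b from
      fun a b => by ext1 n; simp [divħ], smul_sub]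
    abel
  rw [this, map_sub]

theorem curvForm_zagierConnection : curvForm (zagierConnection ν hν) = 0 := by
  simp [curvForm, isFlat_zagierConnection ν hν _ _, fnW]

theorem isFedosovForm_zero : IsFedosovForm (zagierConnection ν hν) 0 where
  equation := by
    have h0 : divħ (formMul 0 0) = 0 := by
      ext1 n
      simp [divħ, formMul, weylMul_zero_left]
    rw [h0, curvForm_zagierConnection]
    ext1 N
    simp [δform, dyW, coeff_covDform, coeff_covD]
  normalised := by simp [δstar]
  degree := by simp

theorem cf_euler (m n : ℕ) (a : FibreSeries) :
    cf m n (MvPowerSeries.X 0 * dy 0 a + MvPowerSeries.X 1 * dy 1 a) =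
      ((m : ℂ) + n) • cf m n a := by
  rw [map_add, cf_X_zero_mul, cf_X_one_mul, add_smul]
  congr 1
  · rcases m with - | m
    · simp
    · simp [cf_dy_zero]
  · rcases n with - | n
    · simp
    · simp [cf_dy_one]

/-- The homotopy formula for `δ` and `δ*`: differentiating `y¹ a + y² b = 0` expresses `c + (Euler
operator) c`, for `c = a` and `c = b`, as `± yⁱ` times the coefficient of `δ`. The operator `1 +
Euler` multiplies the terms of degree `m + n` by `1 + m + n ≠ 0`. -/
theorem orderGE_of_δ {p : ℕ} {a b : FibreSeries}
    (h : MvPowerSeries.X 0 * a + MvPowerSeries.X 1 * b = 0)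
    (hδ : OrderGE p (dy 0 b - dy 1 a)) : OrderGE (p + 1) a ∧ OrderGE (p + 1) b := by
  have key {c s : FibreSeries} {i : Fin 2} (hs : OrderGE p s)
      (h : c + (MvPowerSeries.X 0 * dy 0 c + MvPowerSeries.X 1 * dy 1 c) =
        MvPowerSeries.X i * s) : OrderGE (p + 1) c := by
    intro m n hmn
    have h1 := congrArg (cf m n) h
    rw [map_add, cf_euler, ((orderGE_X i).mul hs) m n (by omega)] at h1
    have h2 : ((1 : ℂ) + (m + n)) • cf m n c = 0 := by rw [add_smul, one_smul, h1]
    refine (smul_eq_zero.1 h2).resolve_left ?_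
    exact_mod_cast (by omega : 1 + (m + n) ≠ 0)
  have h0 := congrArg (dy 0) h
  have h1 := congrArg (dy 1) h
  simp only [dy_add, dy_mul, dy_X, dy_zero] at h0 h1
  constructor
  · refine key (i := 1) hδ.neg ?_
    simp at h0
    linear_combination h0
  · refine key (i := 0) hδ ?_
    simp at h1
    linear_combination h1

/-- Bootstrap on the degree: if `deg r ≥ p + 3`, the equation gives `deg δr ≥ p + 3`, and inverting
`δ` gives `deg r ≥ p + 4`. -/
theorem IsFedosovForm.eq_zero {r : WeylForm} (h : IsFedosovForm (zagierConnection ν hν) r) :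
    r = 0 := by
  have key (p : ℕ) : ∀ i, DegreeGE (p + 3) (r i) := by
    induction p with
    | zero =>
      intro i N m n hmn
      exact h.degree i N _ (by simp; omega)
    | succ p ih =>
      have hδ (N : ℕ) : OrderGE (p + 3 - 2 * N)
          (dy 0 (PowerSeries.coeff N (r 1)) - dy 1 (PowerSeries.coeff N (r 0))) := by
        have e := congrArg (PowerSeries.coeff N) h.equation
        rw [δform, curvForm_zagierConnection, zero_add, map_add, map_sub, coeff_covDform, dyW, dyW,
          PowerSeries.coeff_mk, PowerSeries.coeff_mk, coeff_covD, coeff_covD] at e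
        rw [e]
        have h0 (i j : Fin 2) := ((ih i N).dx j).add ((orderGE_connSeries ν hν j).poisson (ih i N))
        refine ((h0 1 0).sub (h0 0 1)).add ?_
        -- Division by `ħ` costs two degrees, but `2 (p + 3) - 2 ≥ p + 3`; here the initial bound on
        -- `deg r` is used.
        have h1 (i j : Fin 2) : OrderGE (p + 3 + (p + 3) - 2 * (N + 1))
            (PowerSeries.coeff (N + 1) (weylMul (r i) (r j))) := (ih i).weylMul (ih j) (N + 1)
        have h2 := ((h1 0 1).sub (h1 1 0)).smul Complex.I
        rw [← map_sub] at h2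
        change OrderGE _ (Complex.I • PowerSeries.coeff N (divħ (formMul r r)))
        rw [divħ, PowerSeries.coeff_mk]
        exact h2.mono (by omega)
      have hs (N : ℕ) : MvPowerSeries.X 0 * PowerSeries.coeff N (r 0) +
          MvPowerSeries.X 1 * PowerSeries.coeff N (r 1) = 0 := by
        have e := congrArg (PowerSeries.coeff N) h.normalised
        simpa [δstar, yW, PowerSeries.coeff_C_mul] using e
      intro i N
      have := orderGE_of_δ (hs N) (hδ N)
      fin_cases i
      · exact this.1.mono (by omega)
      · exact this.2.mono (by omega)
  funext i
  ext1 N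
  refine fibre_ext fun m n => ?_
  -- This bound exceeds the degree `2 N + m + n` of the chosen coefficient.
  rw [key (m + n + 2 * N) i N m n (by omega)]
  simp

theorem existsUnique_isFedosovForm : ∃! r : WeylForm, IsFedosovForm (zagierConnection ν hν) r :=
  ⟨0, isFedosovForm_zero ν hν, fun _ h => h.eq_zero⟩

theorem fedosovForm_eq_zero : fedosovForm (zagierConnection ν hν) = 0 :=
  (Classical.epsilon_spec (p := IsFedosovForm (zagierConnection ν hν))
    ⟨0, isFedosovForm_zero ν hν⟩).eq_zero

theorem divħ_comm_zero (a : Weyl) : divħ (comm 0 a) = 0 := by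
  ext1 n
  simp [divħ, comm, weylMul_zero_left, weylMul_zero_right]

/-- `D` does not mix powers of `ħ`, so flat sections are found one `ħ`-coefficient at a time. -/
theorem coeff_fedosovD (a : Weyl) (i : Fin 2) (N : ℕ) :
    PowerSeries.coeff N (fedosovD (zagierConnection ν hν)
      (fedosovForm (zagierConnection ν hν)) a i) = flatD ν hν i (PowerSeries.coeff N a) := by
  rw [fedosovForm_eq_zero, fedosovD, Pi.zero_apply, divħ_comm_zero, smul_zero, add_zero, map_add,
    coeff_covD, flatD, map_neg, δ, dyW, PowerSeries.coeff_mk, add_assoc]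

/-- The derivative is expressed through `(1 / 2) • x₂inv` itself, so that this function can be
treated as an atom in `flatD_comm`. -/
theorem pd_half_x₂inv (i : Fin 2) : pd i ((1 / 2 : ℂ) • x₂inv) =
    if i = 1 then -(((1 / 2 : ℂ) • x₂inv) ^ 2 + ((1 / 2 : ℂ) • x₂inv) ^ 2) else 0 := by
  fin_cases i
  · simp [pd_zero_x₂inv]
  · have ht : 2 * algebraMap ℂ Fn (1 / 2) = 1 := by
      rw [← map_ofNat (algebraMap ℂ Fn) 2, ← map_mul]; norm_num
    simp [pd_one_x₂inv, -one_div]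
    simp only [Algebra.smul_def]
    linear_combination (algebraMap ℂ Fn (1 / 2) * x₂inv ^ 2) * ht

theorem two_mul_x₂_mul_half (f : Fn) : 2 * (x₂ * f) * ((1 / 2 : ℂ) • x₂inv) = f := by
  have ht : 2 * algebraMap ℂ Fn (1 / 2) = 1 := by
    rw [← map_ofNat (algebraMap ℂ Fn) 2, ← map_mul]; norm_num
  rw [Algebra.smul_def]
  linear_combination (2 * algebraMap ℂ Fn (1 / 2) * f) * x₂_mul_x₂inv + f * ht

theorem flatD_zero (a : FibreSeries) : flatD ν hν 0 a = -dy 0 a + dx 0 a -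
    (MvPowerSeries.C ((1 / 2 : ℂ) • x₂inv) * (MvPowerSeries.X 1 * dy 0 a) +
      MvPowerSeries.C (x₂ * ofX₁ ν hν) * (MvPowerSeries.X 0 * dy 1 a)) := by
  have h1 := congrArg (MvPowerSeries.C (σ := Fin 2)) (smul_half_eq (x₂ * ofX₁ ν hν))
  have h2 := congrArg (MvPowerSeries.C (σ := Fin 2)) (show (1 / 2 : ℂ) • x₂inv =
    (1 / 4 : ℂ) • x₂inv + (1 / 4 : ℂ) • x₂inv by module)
  rw [map_add] at h1 h2
  simp [-one_div, flatD, connSeries, pow_two, dy_sub, dy_mul, dy_C, dy_X]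
  simp only [map_mul] at h1
  linear_combination (MvPowerSeries.X 1 * dy 0 a) * h2 + (MvPowerSeries.X 0 * dy 1 a) * h1

theorem flatD_one (a : FibreSeries) : flatD ν hν 1 a = -dy 1 a + dx 1 a -
    MvPowerSeries.C ((1 / 2 : ℂ) • x₂inv) *
      (MvPowerSeries.X 0 * dy 0 a - MvPowerSeries.X 1 * dy 1 a) := by
  simp [-one_div, flatD, connSeries, dy_neg, dy_mul, dy_C, dy_X]
  ring

/-- This is `D² = 0` in components. The relation between functions that it requires is again `∂₂ μ =
ν = μ / x₂`. -/
theorem flatD_comm (a : FibreSeries) :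
    flatD ν hν 0 (flatD ν hν 1 a) = flatD ν hν 1 (flatD ν hν 0 a) := by
  have h1 := congrArg (MvPowerSeries.C (σ := Fin 2)) (two_mul_x₂_mul_half (ofX₁ ν hν))
  have h2 : pd 1 (x₂ * ofX₁ ν hν) = ofX₁ ν hν := by simp [pd_mul, pd_one_ofX₁, pd_one_x₂]
  simp only [map_mul, map_ofNat] at h1
  simp only [flatD_zero, flatD_one, dy_add, dy_neg, dy_sub, dy_mul, dy_C, dy_X, dx_add, dx_neg,
    dx_sub, dx_mul, dx_C, dx_X, dy_dx, dy_comm 1 0, dx_comm, pd_half_x₂inv, h2]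
  simp [-one_div]
  linear_combination -(MvPowerSeries.X 0 * dy 1 a) * h1

theorem fedosovDform_fedosovD (a : Weyl) :
    fedosovDform (zagierConnection ν hν) (fedosovForm (zagierConnection ν hν))
      (fedosovD (zagierConnection ν hν) (fedosovForm (zagierConnection ν hν)) a) = 0 := by
  ext1 N
  set ρ := fedosovD (zagierConnection ν hν) (fedosovForm (zagierConnection ν hν)) a with hρ
  have h0 : divħ (formComm 0 ρ) = 0 := by
    ext1 n
    simp [divħ, formComm, formMul, weylMul_zero_left, weylMul_zero_right]
  have h1 := flatD_comm ν hν (PowerSeries.coeff N a)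
  have h (i : Fin 2) : flatD ν hν i (PowerSeries.coeff N a) = PowerSeries.coeff N (ρ i) :=
    (coeff_fedosovD ν hν a i N).symm
  rw [h, h, flatD, flatD] at h1
  rw [fedosovForm_eq_zero, fedosovDform, h0, smul_zero, add_zero, map_add, coeff_covDform,
    coeff_covD, coeff_covD, δform, map_neg, map_sub, dyW, dyW, PowerSeries.coeff_mk,
    PowerSeries.coeff_mk, map_zero]
  linear_combination h1

end Connection

/-! ### Flat sections -/

section Flat

variable (ν : ℝ → ℝ) (hν : ContDiff ℝ ∞ ν)

/-- Moving `2Y` to the right across `B_m` gives `2Y + 2m`, which is the next Pochhammer factor `2Y +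
m + n` plus `m - n`. This is the recursion in the direction `y²`. -/
theorem rcB_poch_succ_right {Ω : Fn} (hΩ : Y Ω = (2 : ℂ) • Ω) (m n : ℕ) (f : Fn) :
    (2 : ℂ) • Y (rcB Ω m (poch m n f)) =
      rcB Ω m (poch m (n + 1) f) + ((m : ℂ) - n) • rcB Ω m (poch m n f) := by
  rw [Y_rcB hΩ, poch_succ_apply, map_add, map_smul, map_smul]
  module

/-- `(Y - m/2) B_m = ½ B_m (2Y + m)`, and `2Y + m` is the lowest factor of `poch m (n + 1)`. This is
the recursion in the direction `y¹`. -/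
theorem rcB_succ_poch {Ω : Fn} (hΩ : Y Ω = (2 : ℂ) • Ω) (m n : ℕ) (f : Fn) :
    rcB Ω (m + 2) (poch (m + 1) n f) = X (rcB Ω (m + 1) (poch (m + 1) n f)) -
      (((m : ℂ) + 1) / 2) • (Ω * rcB Ω m (poch m (n + 1) f)) := by
  rw [rcB_add_two_apply, poch_succ_apply', Y_rcB hΩ]
  congr 1
  simp only [map_add, map_smul]
  rw [← mul_smul_comm, ← mul_smul_comm]
  congr 1
  module

/-- The scalar factor in the coefficient of `(y¹)^m (y²)^n` of a flat section. -/
def liftScalar (m n : ℕ) : ℂ := (-1) ^ n / ((2 : ℂ) ^ n * (m ! : ℂ) * (n ! : ℂ))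

theorem liftScalar_succ_left (m n : ℕ) : ((m : ℂ) + 1) * liftScalar (m + 1) n = liftScalar m n := by
  have : (m : ℂ) + 1 ≠ 0 := by exact_mod_cast m.succ_ne_zero
  have h1 : (m ! : ℂ) ≠ 0 := by exact_mod_cast m.factorial_ne_zero
  have h2 : (n ! : ℂ) ≠ 0 := by exact_mod_cast n.factorial_ne_zero
  simp only [liftScalar, Nat.factorial_succ]
  push_cast
  field_simp

theorem liftScalar_succ_right (m n : ℕ) :
    ((n : ℂ) + 1) * liftScalar m (n + 1) = -(1 / 2) * liftScalar m n := by
  have : (n : ℂ) + 1 ≠ 0 := by exact_mod_cast n.succ_ne_zero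
  have h1 : (m ! : ℂ) ≠ 0 := by exact_mod_cast m.factorial_ne_zero
  have h2 : (n ! : ℂ) ≠ 0 := by exact_mod_cast n.factorial_ne_zero
  simp only [liftScalar, Nat.factorial_succ, pow_succ]
  push_cast
  field_simp

/-- The coefficient of `(y¹)^m (y²)^n` of the flat section with symbol `f`. -/
def liftCoeff (Ω : Fn) (m n : ℕ) (f : Fn) : Fn :=
  liftScalar m n • (x₂ ^ m * x₂inv ^ n * rcB Ω m (poch m n f))

/-- The flat series with constant term `f`. -/
def flatSeries (Ω : Fn) (f : Fn) : FibreSeries := fun d => liftCoeff Ω (d 0) (d 1) f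

theorem cf_flatSeries (Ω : Fn) (m n : ℕ) (f : Fn) :
    cf m n (flatSeries Ω f) = liftCoeff Ω m n f := by
  change flatSeries Ω f _ = _
  simp [flatSeries]

theorem pd_zero_eq (f : Fn) : pd 0 f = x₂ * X f := by
  rw [X_apply, ← mul_assoc, x₂_mul_x₂inv, one_mul]

theorem pd_one_eq (f : Fn) : pd 1 f = -(x₂inv * Y f) := by
  rw [Y_apply]
  linear_combination -pd 1 f * x₂_mul_x₂inv

theorem X_x₂_mul (m n : ℕ) (f : Fn) : X (x₂ ^ m * x₂inv ^ n * f) = x₂ ^ m * x₂inv ^ n * X f := by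
  have h : pd 0 (x₂ ^ m * x₂inv ^ n) = 0 := by
    simp [pd_mul, pd_pow, pd_zero_x₂, pd_zero_x₂inv]
  simp only [X_apply, pd_mul _ _ f, h]
  ring

theorem Y_x₂_mul (m n : ℕ) (f : Fn) : Y (x₂ ^ m * x₂inv ^ n * f) =
    x₂ ^ m * x₂inv ^ n * (Y f + ((n : ℂ) - m) • f) := by
  rw [Y_mul, Y_mul, Y_x₂_pow, Y_x₂inv_pow]
  simp only [Algebra.smul_def, map_sub, map_neg, map_natCast]
  ring

theorem cf_flatD_one (m n : ℕ) (a : FibreSeries) : cf m n (flatD ν hν 1 a) =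
    -(((n : ℂ) + 1) • cf m (n + 1) a) + pd 1 (cf m n a) -
      ((1 / 2 : ℂ) • x₂inv) * (((m : ℂ) - n) • cf m n a) := by
  rw [flatD_one, map_sub, map_add, map_neg, cf_C_mul, cf_dx, cf_dy_one, map_sub, cf_X_zero_mul,
    cf_X_one_mul, sub_smul]
  congr 3
  · rcases m with - | m
    · simp
    · simp [cf_dy_zero]
  · rcases n with - | n
    · simp
    · simp [cf_dy_one]

theorem cf_flatD_zero (m n : ℕ) (a : FibreSeries) : cf m n (flatD ν hν 0 a) =
    -(((m : ℂ) + 1) • cf (m + 1) n a) + pd 0 (cf m n a) -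
      ((1 / 2 : ℂ) • x₂inv * (if n = 0 then 0 else ((m : ℂ) + 1) • cf (m + 1) (n - 1) a) +
        x₂ * ofX₁ ν hν * (if m = 0 then 0 else ((n : ℂ) + 1) • cf (m - 1) (n + 1) a)) := by
  rw [flatD_zero, map_sub, map_add, map_neg, map_add, cf_C_mul, cf_C_mul, cf_dx, cf_dy_zero,
    cf_X_zero_mul, cf_X_one_mul, cf_dy_zero, cf_dy_one]

theorem flatD_one_flatSeries (f : Fn) :
    flatD ν hν 1 (flatSeries (-(ofX₁ ν hν * x₂inv ^ 2)) f) = 0 := by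
  refine fibre_ext fun m n => ?_
  have hb := rcB_poch_succ_right (Y_ofX₁_mul ν hν) m n f
  rw [map_zero, cf_flatD_one, cf_flatSeries, cf_flatSeries, liftCoeff, liftCoeff, smul_smul,
    liftScalar_succ_right, map_smul, pd_one_eq, Y_x₂_mul]
  set b := rcB (-(ofX₁ ν hν * x₂inv ^ 2)) m (poch m n f)
  set b' := rcB (-(ofX₁ ν hν * x₂inv ^ 2)) m (poch m (n + 1) f)
  have hb' : b' = (2 : ℂ) • Y b - ((m : ℂ) - n) • b := by rw [hb]; module
  rw [hb']
  have ht : 2 * algebraMap ℂ Fn (1 / 2) = 1 := by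
    rw [← map_ofNat (algebraMap ℂ Fn) 2, ← map_mul]; norm_num
  simp only [Algebra.smul_def, map_mul, map_neg, map_sub, map_natCast, map_ofNat]
  set K := algebraMap ℂ Fn (liftScalar m n)
  set t := algebraMap ℂ Fn (1 / 2)
  linear_combination (K * x₂ ^ m * x₂inv ^ (n + 1) * (Y b - ((m : Fn) - n) * b)) * ht

/-- In `∂₁ a_{m,n}` the operator `X B_m` is expanded by the recursion. Its `Ω`-term cancels the
contribution of `a_{m-1,n+1}` because `x₂² Ω = -ν`. The mismatch between `poch m n` and `poch (m +
1) n` in `a_{m+1,n}` is, by `poch_sub`, the contribution of `a_{m+1,n-1}`. -/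
theorem flatD_zero_flatSeries (f : Fn) :
    flatD ν hν 0 (flatSeries (-(ofX₁ ν hν * x₂inv ^ 2)) f) = 0 := by
  refine fibre_ext fun m n => ?_
  have ht : 2 * algebraMap ℂ Fn (1 / 2) = 1 := by
    rw [← map_ofNat (algebraMap ℂ Fn) 2, ← map_mul]; norm_num
  have e := x₂_mul_x₂inv
  set Ω := -(ofX₁ ν hν * x₂inv ^ 2) with hΩdef
  have hΩ : Y Ω = (2 : ℂ) • Ω := Y_ofX₁_mul ν hν
  have h1 : X (rcB Ω m (poch m n f)) = rcB Ω (m + 1) (poch m n f) +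
      if m = 0 then 0 else ((m : ℂ) / 2) • (Ω * rcB Ω (m - 1) (poch (m - 1) (n + 1) f)) := by
    rcases m with - | m
    · simp [rcB]
    · rw [rcB_succ_poch hΩ]
      simp
  have h2 : rcB Ω (m + 1) (poch (m + 1) n f) = rcB Ω (m + 1) (poch m n f) +
      if n = 0 then 0 else (n : ℂ) • rcB Ω (m + 1) (poch (m + 1) (n - 1) f) := by
    rcases n with - | n
    · simp [poch_zero]
    · rw [poch_sub, map_add, map_smul]
      simp
  have h3 : (if n = 0 then 0 else ((m : ℂ) + 1) • liftCoeff Ω (m + 1) (n - 1) f) =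
      x₂ * (liftScalar m n • (x₂ ^ m * (if n = 0 then 0 else
        (-2 * (n : ℂ)) • (x₂inv ^ (n - 1) * rcB Ω (m + 1) (poch (m + 1) (n - 1) f))))) := by
    rcases n with - | n
    · simp
    · have := liftScalar_succ_right m n
      have h : liftScalar m n = -2 * ((n : ℂ) + 1) * liftScalar m (n + 1) := by
        linear_combination 2 * this
      simp only [Nat.add_eq_zero_iff, one_ne_zero, and_false, if_false, Nat.add_sub_cancel]
      rw [liftCoeff, smul_smul, liftScalar_succ_left, h, pow_succ]
      simp only [Algebra.smul_def, map_mul, map_neg, map_add, map_natCast, map_ofNat, map_one]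
      push_cast
      ring
  have h4 : (if m = 0 then 0 else ((n : ℂ) + 1) • liftCoeff Ω (m - 1) (n + 1) f) =
      liftScalar m n • (-((m : ℂ) / 2) • (if m = 0 then 0 else
        (x₂ ^ (m - 1) * x₂inv ^ (n + 1) * rcB Ω (m - 1) (poch (m - 1) (n + 1) f)))) := by
    rcases m with - | m
    · simp
    · simp only [Nat.add_eq_zero_iff, one_ne_zero, and_false, if_false, Nat.add_sub_cancel]
      rw [liftCoeff, smul_smul, liftScalar_succ_right, ← liftScalar_succ_left, smul_smul]
      congr 1
      push_cast
      ring
  rw [map_zero, cf_flatD_zero, cf_flatSeries, cf_flatSeries, cf_flatSeries, cf_flatSeries, h3, h4,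
    liftCoeff, liftCoeff, smul_smul, liftScalar_succ_left, map_smul, pd_zero_eq, X_x₂_mul, h1, h2]
  set K := liftScalar m n
  have hm : (if m = 0 then 0 else ((m : ℂ) / 2) • (Ω * rcB Ω (m - 1) (poch (m - 1) (n + 1) f))) =
      ((m : ℂ) / 2) • (Ω * if m = 0 then 0 else rcB Ω (m - 1) (poch (m - 1) (n + 1) f)) := by
    split_ifs <;> simp
  have hm' : (if m = 0 then 0 else
      x₂ ^ (m - 1) * x₂inv ^ (n + 1) * rcB Ω (m - 1) (poch (m - 1) (n + 1) f)) * x₂ =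
      x₂ ^ m * x₂inv ^ (n + 1) *
        if m = 0 then 0 else rcB Ω (m - 1) (poch (m - 1) (n + 1) f) := by
    rcases m with - | m
    · simp
    · simp only [Nat.add_eq_zero_iff, one_ne_zero, and_false, if_false, Nat.add_sub_cancel]
      ring
  have hn : (if n = 0 then 0 else (n : ℂ) • rcB Ω (m + 1) (poch (m + 1) (n - 1) f)) =
      (n : ℂ) • if n = 0 then 0 else rcB Ω (m + 1) (poch (m + 1) (n - 1) f) := by
    split_ifs <;> simp
  have hn' : (if n = 0 then 0 else
      (-2 * (n : ℂ)) • (x₂inv ^ (n - 1) * rcB Ω (m + 1) (poch (m + 1) (n - 1) f))) * x₂inv =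
      (-2 * (n : ℂ)) • (x₂inv ^ n *
        if n = 0 then 0 else rcB Ω (m + 1) (poch (m + 1) (n - 1) f)) := by
    rcases n with - | n
    · simp
    · simp only [Nat.add_eq_zero_iff, one_ne_zero, and_false, if_false, Nat.add_sub_cancel]
      rw [smul_mul_assoc]
      congr 1
      ring
  rw [hm, hn]
  -- The boundary cases `m = 0` and `n = 0` are now contained in `hm'` and `hn'`; the rest is a
  -- uniform identity in the atoms `u`, `v`, `u'`, `v'`.
  generalize (if m = 0 then 0 else rcB Ω (m - 1) (poch (m - 1) (n + 1) f)) = u at *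
  generalize (if n = 0 then 0 else rcB Ω (m + 1) (poch (m + 1) (n - 1) f)) = v at *
  generalize (if m = 0 then 0 else
    x₂ ^ (m - 1) * x₂inv ^ (n + 1) * rcB Ω (m - 1) (poch (m - 1) (n + 1) f)) = u' at *
  generalize (if n = 0 then 0 else
    (-2 * (n : ℂ)) • (x₂inv ^ (n - 1) * rcB Ω (m + 1) (poch (m + 1) (n - 1) f))) = v' at *
  rw [hΩdef]
  simp only [Algebra.smul_def, map_mul, map_neg, map_natCast, map_ofNat, div_eq_mul_one_div (m : ℂ)]
    at hn' ⊢
  set K' := algebraMap ℂ Fn K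
  set t := algebraMap ℂ Fn (1 / 2)
  linear_combination (K' * m * t * ofX₁ ν hν) * hm' - (t * K' * x₂ ^ (m + 1)) * hn' -
    (K' * m * t * x₂ ^ m * x₂inv ^ (n + 1) * ofX₁ ν hν * u) * e +
    (K' * x₂ ^ (m + 1) * x₂inv ^ n * n * v) * ht

/-- The `y²`-equation propagates the vanishing of `a_{m,0}` along row `m`; the `y¹`-equation at `n =
0` gets `a_{m+1,0}` from rows `m` and `m - 1`. -/
theorem eq_zero_of_flatD {a : FibreSeries} (h0 : flatD ν hν 0 a = 0) (h1 : flatD ν hν 1 a = 0)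
    (h : cf 0 0 a = 0) : a = 0 := by
  have cancel (n : ℕ) {u : Fn} (hu : -(((n : ℂ) + 1) • u) = 0) : u = 0 :=
    (smul_eq_zero.1 (neg_eq_zero.1 hu)).resolve_left (by exact_mod_cast n.succ_ne_zero)
  have row (m : ℕ) (hm : cf m 0 a = 0) (n : ℕ) : cf m n a = 0 := by
    induction n with
    | zero => exact hm
    | succ n ih =>
      have e := cf_flatD_one ν hν m n a
      rw [h1, map_zero, ih, map_zero, smul_zero, mul_zero, sub_zero, add_zero] at e
      exact cancel n e.symm
  have key (m : ℕ) : ∀ n, cf m n a = 0 := by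
    induction m using Nat.strong_induction_on with
    | _ m ih =>
      refine row m ?_
      rcases m with - | m
      · exact h
      · have e := cf_flatD_zero ν hν m 0 a
        rw [h0, map_zero, ih m (by omega), map_zero] at e
        refine cancel m ?_
        rw [e]
        rcases m with - | m
        · simp
        · simp [ih m (by omega)]
  exact fibre_ext fun m n => by rw [key, map_zero]

theorem flatD_sub (i : Fin 2) (a b : FibreSeries) :
    flatD ν hν i (a - b) = flatD ν hν i a - flatD ν hν i b := by
  simp only [flatD, dy_sub, dx_sub]
  ring

theorem cf_zero_zero_flatSeries (Ω f : Fn) : cf 0 0 (flatSeries Ω f) = f := by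
  simp [cf_flatSeries, liftCoeff, liftScalar, rcB, poch_zero]

/-- The flat section with symbol `f`. -/
def flatSection (Ω : Fn) (f : PowerSeries Fn) : Weyl :=
  PowerSeries.mk fun N => flatSeries Ω (PowerSeries.coeff N f)

theorem isFlatLift_iff (f : PowerSeries Fn) (a : Weyl) :
    IsFlatLift (zagierConnection ν hν) f a ↔ a = flatSection (-(ofX₁ ν hν * x₂inv ^ 2)) f := by
  have hs (N : ℕ) (a : Weyl) : PowerSeries.coeff N (symbol a) = cf 0 0 (PowerSeries.coeff N a) := by
    rw [symbol, PowerSeries.coeff_mk, cf_zero_zero]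
  constructor
  · rintro ⟨h1, h2⟩
    have hD (i : Fin 2) (N : ℕ) : flatD ν hν i (PowerSeries.coeff N a) = 0 := by
      rw [← coeff_fedosovD, h1]
      simp
    ext1 N
    rw [flatSection, PowerSeries.coeff_mk, ← sub_eq_zero]
    refine eq_zero_of_flatD ν hν ?_ ?_ ?_
    · rw [flatD_sub, hD, flatD_zero_flatSeries, sub_zero]
    · rw [flatD_sub, hD, flatD_one_flatSeries, sub_zero]
    · rw [map_sub, cf_zero_zero_flatSeries, ← hs, h2, sub_self]
  · rintro rfl
    constructor
    · funext i
      ext1 N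
      rw [coeff_fedosovD, flatSection, PowerSeries.coeff_mk, Pi.zero_apply, map_zero]
      fin_cases i
      · exact flatD_zero_flatSeries ν hν _
      · exact flatD_one_flatSeries ν hν _
    · ext1 N
      rw [hs, flatSection, PowerSeries.coeff_mk, cf_zero_zero_flatSeries]

theorem existsUnique_isFlatLift (f : PowerSeries Fn) :
    ∃! a : Weyl, IsFlatLift (zagierConnection ν hν) f a :=
  ⟨_, (isFlatLift_iff ν hν f _).2 rfl, fun _ h => (isFlatLift_iff ν hν f _).1 h⟩

theorem flatLift_eq (f : PowerSeries Fn) : flatLift (zagierConnection ν hν) f =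
    flatSection (-(ofX₁ ν hν * x₂inv ^ 2)) f :=
  (isFlatLift_iff ν hν f _).1 (Classical.epsilon_spec (p := IsFlatLift (zagierConnection ν hν) f)
    (existsUnique_isFlatLift ν hν f).exists)

theorem weylCoeff_flatLift (f : PowerSeries Fn) (N m n : ℕ) :
    weylCoeff (flatLift (zagierConnection ν hν) f) N m n =
      liftCoeff (-(ofX₁ ν hν * x₂inv ^ 2)) m n (PowerSeries.coeff N f) := by
  rw [flatLift_eq, ← cf_flatSeries, weylCoeff, flatSection, PowerSeries.coeff_mk, cf]

/-! ### The star product -/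

theorem cf_iterate_dy_zero (j m n : ℕ) (a : FibreSeries) :
    (m ! : ℂ) • cf m n ((dy 0)^[j] a) = ((m + j)! : ℂ) • cf (m + j) n a := by
  induction j generalizing m with
  | zero => rfl
  | succ j ih =>
    have := ih (m + 1)
    rw [Function.iterate_succ_apply', cf_dy_zero, smul_smul, ← add_assoc, add_right_comm, ← this,
      Nat.factorial_succ]
    push_cast
    rw [mul_comm]

theorem cf_iterate_dy_one (j m n : ℕ) (a : FibreSeries) :
    (n ! : ℂ) • cf m n ((dy 1)^[j] a) = ((n + j)! : ℂ) • cf m (n + j) a := by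
  induction j generalizing n with
  | zero => rfl
  | succ j ih =>
    have := ih (n + 1)
    rw [Function.iterate_succ_apply', cf_dy_one, smul_smul, ← add_assoc, add_right_comm, ← this,
      Nat.factorial_succ]
    push_cast
    rw [mul_comm]

theorem cf_zero_zero_iterate_dy (j l : ℕ) (a : FibreSeries) :
    cf 0 0 ((dy 1)^[l] ((dy 0)^[j] a)) = ((j ! : ℂ) * (l ! : ℂ)) • cf j l a := by
  have h1 := cf_iterate_dy_one l 0 0 ((dy 0)^[j] a)
  have h2 := cf_iterate_dy_zero j 0 l a
  simp only [Nat.factorial_zero, Nat.cast_one, one_smul, zero_add] at h1 h2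
  rw [h1, h2, smul_smul, mul_comm]

theorem iterate_dy_comm (j l : ℕ) (a : FibreSeries) :
    (dy 0)^[l] ((dy 1)^[j] a) = (dy 1)^[j] ((dy 0)^[l] a) :=
  (Function.Commute.iterate_iterate (fun x => dy_comm 0 1 x) l j) a

/-- The factors `x₂^{l-j}` and `x₂^{j-l}` of the two lifts cancel. Their scalars contribute
`(-1/2)^k`, turning `(-i/2)^k` into `(i/4)^k`; the remaining sign `(-1)^l` changes `B_l` into `A_l`.
-/
theorem cf_bidiff_flatSeries (Ω : Fn) (k : ℕ) (f g : Fn) :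
    ((-Complex.I / 2) ^ k / (k ! : ℂ)) • cf 0 0 (bidiff k (flatSeries Ω f) (flatSeries Ω g)) =
      (Complex.I / 4) ^ k • rcTerm Ω k f g := by
  have hmul (a b : FibreSeries) : cf 0 0 (a * b) = cf 0 0 a * cf 0 0 b := by
    simp [cf_zero_zero]
  rw [bidiff_eq_sum, rcTerm, map_sum, Finset.smul_sum, Finset.smul_sum,
    -- `bidiff_eq_sum` lists first the number of `∂/∂y²` acting on `f`, whereas `rcTerm` lists first
    -- the number of `∂/∂y¹`.
    ← Finset.Nat.sum_antidiagonal_swap]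
  refine Finset.sum_congr rfl fun ⟨l, j⟩ hlj => ?_
  have hk : l + j = k := Finset.HasAntidiagonal.mem_antidiagonal.1 hlj
  simp only [Prod.swap]
  rw [iterate_dy_comm, map_nsmul, cf_smul, hmul, cf_zero_zero_iterate_dy, cf_zero_zero_iterate_dy,
    cf_flatSeries, cf_flatSeries, liftCoeff, liftCoeff, rcA_apply]
  have hc : (k.choose j : ℂ) = (k ! : ℂ) / ((l ! : ℂ) * (j ! : ℂ)) := by
    subst hk
    rw [Nat.add_choose, Nat.cast_div (Nat.factorial_mul_factorial_dvd_factorial_add _ _)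
      (by exact_mod_cast (Nat.mul_pos l.factorial_pos j.factorial_pos).ne')]
    push_cast
    rfl
  have hx : (x₂ ^ l * x₂inv ^ j) * (x₂ ^ j * x₂inv ^ l) = 1 := by
    rw [mul_mul_mul_comm, mul_comm (x₂inv ^ j), ← pow_add, ← pow_add, ← mul_pow,
      x₂_mul_x₂inv, one_pow]
  rw [← Nat.cast_smul_eq_nsmul ℂ, hc]
  set u := rcB Ω l (poch l j f)
  set v := rcB Ω j (poch j l g)
  have huv : (x₂ ^ l * x₂inv ^ j * u) * (x₂ ^ j * x₂inv ^ l * v) = u * v := by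
    linear_combination (u * v) * hx
  simp only [smul_mul_smul_comm, smul_smul, huv]
  congr 1
  have h1 : (k ! : ℂ) ≠ 0 := by exact_mod_cast k.factorial_ne_zero
  have h2 : (l ! : ℂ) ≠ 0 := by exact_mod_cast l.factorial_ne_zero
  have h3 : (j ! : ℂ) ≠ 0 := by exact_mod_cast j.factorial_ne_zero
  have hI : (-Complex.I / 2) ^ k = (-1) ^ (l + j) * 2 ^ (l + j) * (Complex.I / 4) ^ k := by
    rw [hk, ← mul_pow, ← mul_pow]
    congr 1
    ring
  have hs (n : ℕ) : ((-1 : ℂ) ^ n) * (-1) ^ n = 1 := by rw [← mul_pow]; simp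
  rw [hI, pow_add, pow_add]
  simp only [liftScalar]
  field_simp
  rw [pow_two, pow_two, hs, hs, one_mul]

theorem fedosovStar_eq (f g : PowerSeries Fn) : fedosovStar (zagierConnection ν hν) f g =
    rcSeries (-(ofX₁ ν hν * x₂inv ^ 2)) (Complex.I / 4) f g := by
  ext1 N
  rw [fedosovStar, symbol, rcSeries, PowerSeries.coeff_mk, PowerSeries.coeff_mk, weylMul,
    PowerSeries.coeff_mk, ← cf_zero_zero, map_sum]
  refine Finset.sum_congr rfl fun kl _ => ?_
  rw [map_sum]
  refine Finset.sum_congr rfl fun pq _ => ?_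
  rw [cf_smul, flatLift_eq, flatLift_eq, flatSection, flatSection, PowerSeries.coeff_mk,
    PowerSeries.coeff_mk, cf_bidiff_flatSeries]

end Flat

/-! ### Zagier's brackets -/

/-- Generalised binomial coefficients as rising factorials, valid for weights of either sign. -/
theorem choose_mul_factorial (k : ℤ) (r s : ℕ) :
    ((Ring.choose (((r + s : ℕ) : ℤ) + k - 1) s : ℤ) : ℂ) * (s ! : ℂ) =
      (ascPochhammer ℂ s).eval ((k : ℂ) + r) := by
  have h := Ring.factorial_nsmul_multichoose_eq_ascPochhammer (k + r : ℤ) s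
  rw [Ring.multichoose_eq, Polynomial.ascPochhammer_smeval_eq_eval, nsmul_eq_mul,
    show (k + r + s - 1 : ℤ) = ((r + s : ℕ) : ℤ) + k - 1 by push_cast; ring] at h
  have h' := congrArg (Int.castRingHom ℂ) h
  rw [← Polynomial.eval₂_hom, ← Polynomial.eval_map, ascPochhammer_map] at h'
  simp only [map_mul, map_natCast, eq_intCast, Int.cast_add, Int.cast_natCast] at h'
  rw [mul_comm]
  exact h'

theorem poch_apply_of_weight {k : ℤ} {f : Fn} (hf : Y f = ((k : ℂ) / 2) • f) (j n : ℕ) :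
    poch j n f = (ascPochhammer ℂ n).eval ((k : ℂ) + j) • f := by
  induction n with
  | zero => simp [poch_zero]
  | succ n ih =>
    rw [poch_succ_apply, ih, map_smul, hf, ascPochhammer_succ_eval]
    module

/-- `B_r f` has `Y`-weight `k/2 + r`, so `Y - r/2` acts on it as `(k + r)/2`; the factor `-1/2`
passes into `Φ = -Ω/2`. -/
theorem rcB_eq_zagierSeq {Ω : Fn} (hΩ : Y Ω = (2 : ℂ) • Ω) {k : ℤ} {f : Fn}
    (hf : Y f = ((k : ℂ) / 2) • f) (r : ℕ) :
    rcB Ω r f = zagierSeq (fun _ => X) (-((1 / 2 : ℂ) • Ω)) k f r := by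
  induction r using Nat.twoStepInduction with
  | zero => rfl
  | one => rfl
  | more r h0 h1 =>
    rw [rcB_add_two_apply, zagierSeq, ← h0, ← h1, Y_rcB hΩ, hf, sub_eq_add_neg, map_smul,
      ← add_smul, ← sub_smul, mul_smul_comm, ← neg_smul (1 / 2 : ℂ) Ω, smul_mul_assoc]
    congr 1
    push_cast
    module

theorem rcTerm_eq_zagierBracket {Ω : Fn} (hΩ : Y Ω = (2 : ℂ) • Ω) {k l : ℤ} {f g : Fn}
    (hf : Y f = ((k : ℂ) / 2) • f) (hg : Y g = ((l : ℂ) / 2) • g) (n : ℕ) :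
    rcTerm Ω n f g = zagierBracket (fun _ => X) (-((1 / 2 : ℂ) • Ω)) k l n f g := by
  refine Finset.sum_congr rfl fun ⟨r, s⟩ hrs => ?_
  obtain rfl : r + s = n := Finset.HasAntidiagonal.mem_antidiagonal.1 hrs
  have h1 := choose_mul_factorial k r s
  have h2 := choose_mul_factorial l s r
  rw [add_comm s r] at h2
  simp only
  rw [poch_apply_of_weight hf, poch_apply_of_weight hg, ← h1, ← h2, rcA_apply, map_smul, map_smul,
    ← rcB_eq_zagierSeq hΩ hf, ← rcB_eq_zagierSeq hΩ hg]
  simp only [smul_mul_smul_comm, smul_smul]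
  congr 1
  have h1 : (r ! : ℂ) ≠ 0 := by exact_mod_cast r.factorial_ne_zero
  have h2 : (s ! : ℂ) ≠ 0 := by exact_mod_cast s.factorial_ne_zero
  push_cast
  field_simp

theorem rcTerm_zero_left (Ω : Fn) (n : ℕ) (g : Fn) : rcTerm Ω n 0 g = 0 := by simp [rcTerm]

theorem rcTerm_zero_right (Ω : Fn) (n : ℕ) (f : Fn) : rcTerm Ω n f 0 = 0 := by simp [rcTerm]

theorem rcSeries_C (Ω : Fn) (t : ℂ) (f g : Fn) :
    rcSeries Ω t (PowerSeries.C f) (PowerSeries.C g) =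
      PowerSeries.mk fun n => t ^ n • rcTerm Ω n f g := by
  ext1 N
  rw [rcSeries, PowerSeries.coeff_mk, PowerSeries.coeff_mk, Finset.sum_eq_single (N, 0)]
  · simp
  · rintro ⟨n, l⟩ h1 h2
    refine Finset.sum_eq_zero fun ⟨p, q⟩ hpq => ?_
    have h1 := Finset.HasAntidiagonal.mem_antidiagonal.1 h1
    have hpq := Finset.HasAntidiagonal.mem_antidiagonal.1 hpq
    have hl : l ≠ 0 := by rintro rfl; simp_all
    rcases p with - | p
    · have : q ≠ 0 := by rintro rfl; simp_all
      simp [PowerSeries.coeff_C, this, rcTerm_zero_right]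
    · simp [PowerSeries.coeff_C, rcTerm_zero_left]
  · simp

theorem fedosovStar_C_eq_zagierBracket (ν : ℝ → ℝ) (hν : ContDiff ℝ ∞ ν) {k l : ℤ} {f g : Fn}
    (hf : Y f = ((k : ℂ) / 2) • f) (hg : Y g = ((l : ℂ) / 2) • g) :
    fedosovStar (zagierConnection ν hν) (PowerSeries.C f) (PowerSeries.C g) =
      PowerSeries.mk fun n => (Complex.I / 4) ^ n •
        zagierBracket (fun _ => X) ((1 / 2 : ℂ) • (ofX₁ ν hν * x₂inv ^ 2)) k l n f g := by
  rw [fedosovStar_eq, rcSeries_C]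
  congr 1
  funext n
  rw [rcTerm_eq_zagierBracket (Y_ofX₁_mul ν hν) hf hg, smul_neg, neg_neg]

/-! ### Restrictions of holomorphic functions to horizontal lines -/

section Horizontal

open UpperHalfPlane

theorem pd_apply_of_hasDerivAt (i : Fin 2) (f : Fn) (p : M) {u : ℝ → ℂ} {u' : ℂ}
    (h : ∀ᶠ t in nhds (0 : ℝ), ext f.1 ((p : ℝ × ℝ) + t • coordVec i) = u t)
    (hu : HasDerivAt u u' 0) : (pd i f).1 p = u' := by
  change fderiv ℝ (ext f.1) p (coordVec i) = _
  rw [← (differentiableAt_ext f p.2).lineDeriv_eq_fderiv, lineDeriv, Filter.EventuallyEq.deriv_eq h,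
    hu.deriv]

theorem ddz_mdiff {F : ℍ → ℂ} (hF : MDiff F) : MDiff (ddz F) := by
  rw [UpperHalfPlane.mdifferentiable_iff] at hF ⊢
  refine (hF.deriv isOpen_upperHalfPlaneSet).congr fun z hz => ?_
  simp [ddz, ofComplex_apply_of_im_pos hz]

theorem ddz_iterate_mdiff {F : ℍ → ℂ} (hF : MDiff F) (r : ℕ) : MDiff (ddz^[r] F) := by
  induction r with
  | zero => exact hF
  | succ r ih => rw [Function.iterate_succ_apply']; exact ddz_mdiff ih

theorem ofComplex_horizontal (c : ℝ) (hc : 0 < c) (x : ℝ) :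
    ofComplex ((x : ℂ) + c * Complex.I) = horizontal c hc x :=
  ofComplex_apply_of_im_pos (by simpa using hc)

variable (c : ℝ) (hc : 0 < c)

/-- For holomorphic `F` the derivative in `x₁` is the complex derivative, and the factor `1 / x₂` is
exactly a weight increase of two. -/
theorem X_horizontalLift (k : ℤ) {F : ℍ → ℂ} (hF : MDiff F) :
    X (horizontalLift c hc k F hF) = horizontalLift c hc (k + 2) (ddz F) (ddz_mdiff hF) := by
  rw [Fn.ext_iff']
  intro p
  have hp : 0 < (p : ℝ × ℝ).2 := p.2
  have hd : HasDerivAt (F ∘ ofComplex) (ddz F (horizontal c hc p.1.1))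
      (((p.1.1 : ℝ) : ℂ) + c * Complex.I) := by
    have := (UpperHalfPlane.mdifferentiableAt_iff.mp (hF (horizontal c hc p.1.1))).hasDerivAt
    exact this
  have h1 : (pd 0 (horizontalLift c hc k F hF)).1 p =
      ((p.1.2 ^ (-(k : ℝ) / 2) : ℝ) : ℂ) * ddz F (horizontal c hc p.1.1) := by
    refine pd_apply_of_hasDerivAt 0 _ p (u := fun t => ((p.1.2 ^ (-(k : ℝ) / 2) : ℝ) : ℂ) *
      (F ∘ ofComplex) ((((p.1.1 : ℝ) : ℂ) + t) + c * Complex.I)) (.of_forall fun t => ?_) ?_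
    · have ht : (p : ℝ × ℝ) + t • coordVec 0 ∈ M := by simpa [M, coordVec] using hp
      rw [ext_apply _ ht]
      simp [horizontalLift, coordVec, ← ofComplex_horizontal]
    · refine HasDerivAt.const_mul _ ?_
      have h0 : HasDerivAt (fun z : ℂ => (F ∘ ofComplex) ((((p.1.1 : ℝ) : ℂ) + z) + c * Complex.I))
          (ddz F (horizontal c hc p.1.1)) ((0 : ℝ) : ℂ) := by
        have h2 : HasDerivAt (fun z : ℂ => (((p.1.1 : ℝ) : ℂ) + z) + c * Complex.I) 1
            ((0 : ℝ) : ℂ) := ((hasDerivAt_id _).const_add _).add_const _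
        have h3 := HasDerivAt.comp (h₂ := F ∘ ofComplex) ((0 : ℝ) : ℂ) (by simpa using hd) h2
        simpa using! h3
      exact h0.comp_ofReal
  rw [X_apply]
  change (x₂inv.1 p : ℂ) * (pd 0 (horizontalLift c hc k F hF)).1 p = _
  rw [h1, ← mul_assoc]
  change ((p.1.2⁻¹ : ℝ) : ℂ) * _ * _ = ((p.1.2 ^ (-((k + 2 : ℤ) : ℝ) / 2) : ℝ) : ℂ) * _
  congr 1
  rw [← Complex.ofReal_mul, ← Real.rpow_neg_one, ← Real.rpow_add hp]
  congr 2
  push_cast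
  ring

theorem Y_horizontalLift (k : ℤ) {F : ℍ → ℂ} (hF : MDiff F) :
    Y (horizontalLift c hc k F hF) = ((k : ℂ) / 2) • horizontalLift c hc k F hF := by
  rw [Fn.ext_iff']
  intro p
  have hp : 0 < (p : ℝ × ℝ).2 := p.2
  have h1 : (pd 1 (horizontalLift c hc k F hF)).1 p =
      (((-(k : ℝ) / 2) * p.1.2 ^ (-(k : ℝ) / 2 - 1) : ℝ) : ℂ) * F (horizontal c hc p.1.1) := by
    refine pd_apply_of_hasDerivAt 1 _ p (u := fun t =>
      (((p.1.2 + t) ^ (-(k : ℝ) / 2) : ℝ) : ℂ) * F (horizontal c hc p.1.1)) ?_ ?_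
    · filter_upwards [lt_mem_nhds (neg_lt_zero.2 hp)] with t ht
      have ht : (p : ℝ × ℝ) + t • coordVec 1 ∈ M := by
        simp [M, coordVec]
        linarith
      rw [ext_apply _ ht]
      simp [horizontalLift, coordVec]
    · refine HasDerivAt.mul_const (HasDerivAt.ofReal_comp ?_) _
      have h2 := (Real.hasDerivAt_rpow_const (x := p.1.2 + 0) (p := -(k : ℝ) / 2)
        (Or.inl (by simpa using hp.ne'))).comp (0 : ℝ) ((hasDerivAt_id (0 : ℝ)).const_add p.1.2)
      simpa using! h2
  rw [Y_apply]
  change -((p.1.2 : ℂ) * (pd 1 (horizontalLift c hc k F hF)).1 p) =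
    ((k : ℂ) / 2) * (((p.1.2 ^ (-(k : ℝ) / 2) : ℝ) : ℂ) * F (horizontal c hc p.1.1))
  rw [h1, Real.rpow_sub_one hp.ne']
  have : (p.1.2 : ℂ) ≠ 0 := Complex.ofReal_ne_zero.2 hp.ne'
  push_cast
  field_simp

theorem horizontalLift_congr {k l : ℤ} (h : k = l) {F : ℍ → ℂ} (hF : MDiff F) :
    horizontalLift c hc k F hF = horizontalLift c hc l F hF := by subst h; rfl

theorem zagierSeq_zero_horizontalLift (k : ℤ) {F : ℍ → ℂ} (hF : MDiff F) (r : ℕ) :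
    zagierSeq (fun _ => X) 0 k (horizontalLift c hc k F hF) r =
      horizontalLift c hc (k + 2 * r) (ddz^[r] F) (ddz_iterate_mdiff hF r) := by
  have succ (r : ℕ) : X (horizontalLift c hc (k + 2 * r) (ddz^[r] F) (ddz_iterate_mdiff hF r)) =
      horizontalLift c hc (k + 2 * (r + 1 : ℕ)) (ddz^[r + 1] F) (ddz_iterate_mdiff hF (r + 1)) := by
    rw [X_horizontalLift]
    simp only [Function.iterate_succ_apply']
    exact horizontalLift_congr c hc (by push_cast; ring) _
  induction r using Nat.twoStepInduction with
  | zero => exact horizontalLift_congr c hc (by simp) _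
  | one =>
    rw [← succ 0]
    exact congrArg X (horizontalLift_congr c hc (by simp) _)
  | more r h0 h1 => rw [zagierSeq, h1, succ, zero_mul, smul_zero, add_zero]

theorem coeff_fedosovStar_horizontalLift (k l : ℤ) {F G : ℍ → ℂ} (hF : MDiff F) (hG : MDiff G)
    (n : ℕ) (p : M) :
    (PowerSeries.coeff n (fedosovStar (zagierConnection (fun _ => 0) contDiff_const)
      (PowerSeries.C (horizontalLift c hc k F hF))
      (PowerSeries.C (horizontalLift c hc l G hG)))).1 p =
    (Complex.I / 4) ^ n * ((p.1.2 ^ (-((k + l + 2 * n : ℤ) : ℝ) / 2) : ℝ) : ℂ) *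
      rankinCohen k l n F G (horizontal c hc p.1.1) := by
  have hp : 0 < (p : ℝ × ℝ).2 := p.2
  have h0 : ofX₁ (fun _ => 0) contDiff_const = 0 := by
    rw [Fn.ext_iff']
    intro p
    simp [ofX₁]
  rw [fedosovStar_C_eq_zagierBracket _ _ (Y_horizontalLift c hc k hF) (Y_horizontalLift c hc l hG),
    PowerSeries.coeff_mk, h0, zero_mul, smul_zero]
  change (Complex.I / 4) ^ n * (zagierBracket _ _ _ _ _ _ _ : Fn).1 p = _
  rw [mul_assoc]
  congr 1
  rw [zagierBracket, rankinCohen, Finset.sum_apply, Finset.mul_sum, AddSubmonoidClass.coe_finsetSum,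
    Finset.sum_apply]
  refine Finset.sum_congr rfl fun ⟨r, s⟩ hrs => ?_
  obtain rfl : r + s = n := Finset.HasAntidiagonal.mem_antidiagonal.1 hrs
  rw [zagierSeq_zero_horizontalLift, zagierSeq_zero_horizontalLift]
  have e : p.1.2 ^ (-((k + l + 2 * (r + s : ℕ) : ℤ) : ℝ) / 2) =
      p.1.2 ^ (-((k + 2 * r : ℤ) : ℝ) / 2) * p.1.2 ^ (-((l + 2 * s : ℤ) : ℝ) / 2) := by
    rw [← Real.rpow_add hp]
    congr 1
    push_cast
    ring
  rw [e]
  simp [horizontalLift]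
  ring

end Horizontal

/-! ### Ramanujan's identity for the derivative of `E₂` -/

section Ramanujan

open UpperHalfPlane Filter Topology Function
open scoped ModularForm
open Derivative EisensteinSeries

theorem periodic_of_hasSum {f : ℍ → ℂ} {c : ℕ → ℂ}
    (hf : ∀ τ : ℍ, HasSum (fun m ↦ c m • Periodic.qParam 1 τ ^ m) (f τ)) :
    Periodic (f ∘ ofComplex) ((1 : ℝ) : ℂ) := by
  intro w
  by_cases hw : 0 < w.im
  · have hw' : 0 < (w + ((1 : ℝ) : ℂ)).im := by simpa using hw
    simp only [Function.comp_apply]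
    rw [ofComplex_apply_of_im_pos hw, ofComplex_apply_of_im_pos hw']
    refine (hf _).unique ?_
    have h := hf ⟨w, hw⟩
    convert! h using 4
    simp [Periodic.qParam, mul_add, Complex.exp_add, Complex.exp_two_pi_mul_I]
  · have hw' : (w + ((1 : ℝ) : ℂ)).im ≤ 0 := by simpa using hw
    simp only [Function.comp_apply]
    rw [ofComplex_apply_of_im_nonpos (not_lt.1 hw), ofComplex_apply_of_im_nonpos hw']

/-- The function of `q` extends analytically to `q = 0` with value the constant term. Stated through
the `q`-expansion alone, since it must cover `E₂`, which is not modular. -/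
theorem tendsto_of_hasSum {f : ℍ → ℂ} {c : ℕ → ℂ} (hd : MDiff f)
    (hf : ∀ τ : ℍ, HasSum (fun m ↦ c m • Periodic.qParam 1 τ ^ m) (f τ)) :
    Tendsto f atImInfty (𝓝 (c 0)) := by
  have hper := periodic_of_hasSum hf
  have hb := isBoundedAtImInfty_of_hasSum_qExpansion one_pos hf
  have han := analyticAt_cuspFunction_zero one_pos hper hd hb
  have h0 : c 0 = cuspFunction 1 f 0 := by
    have := (hasFPowerSeriesOnBall_cuspFunction one_pos han hf).coeff_zero (fun _ => 0)
    simpa using this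
  have h1 : (cuspFunction 1 f ∘ fun τ : ℍ ↦ Periodic.qParam 1 (τ : ℂ)) = f := by
    funext τ
    simpa using eq_cuspFunction τ one_ne_zero hper
  have := han.continuousAt.tendsto.comp (qParam_tendsto_atImInfty one_pos)
  rw [h0]
  convert! this using 1
  exact h1.symm

theorem tendsto_E2 : Tendsto E2 atImInfty (𝓝 1) := by
  have := tendsto_of_hasSum (c := fun m => if m = 0 then 1 else -24 * ArithmeticFunction.sigma 1 m)
    E2_mdifferentiable fun τ => by
      simpa only [Function.Periodic.qParam, Complex.ofReal_one, div_one] using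
        hasSum_qExpansion_E2 (z := τ)
  simpa using this

theorem tendsto_E₄ : Tendsto (ModularForm.E₄ : ℍ → ℂ) atImInfty (𝓝 1) := by
  have := tendsto_of_hasSum (c := fun m => (qExpansion 1 ModularForm.E₄).coeff m)
    ModularForm.E₄.holo' fun τ =>
      ModularForm.hasSum_qExpansion _ one_pos one_mem_strictPeriods_SL τ
  simpa [E_qExpansion_coeff_zero (k := 4) (by norm_num) ⟨2, rfl⟩] using this

theorem isZeroAtImInfty_D {F : ℍ → ℂ} (hF : MDiff F) (hb : IsBoundedAtImInfty F) :
    IsZeroAtImInfty (normalizedDerivOfComplex F) := by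
  obtain ⟨B, A, hBA⟩ := isBoundedAtImInfty_iff.1 hb
  rw [isZeroAtImInfty_iff]
  intro ε hε
  -- Cauchy's estimate on the disc of radius `Im z / 2`: the first bound keeps the disc above height
  -- `A`, the second makes the estimate at most `ε`.
  refine ⟨max (2 * |A| + 1) (‖(2 * (Real.pi : ℂ) * Complex.I)⁻¹‖ * |B| * 2 / ε), fun z hz => ?_⟩
  have hz1 : 2 * |A| + 1 ≤ z.im := (le_max_left _ _).trans hz
  have hz2 := (le_max_right _ _).trans hz
  have hzp := z.im_pos
  have hR : 0 < z.im / 2 := by positivity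
  have him {w : ℂ} (hw : w ∈ Metric.closedBall (z : ℂ) (z.im / 2)) : z.im / 2 ≤ w.im := by
    have h1 := (Complex.abs_im_le_norm (w - z)).trans (by simpa [dist_eq_norm] using hw)
    have h2 := (abs_le.1 h1).1
    simp only [Complex.sub_im, coe_im] at h2
    linarith
  have hd : DifferentiableOn ℂ (F ∘ ofComplex) (Metric.closedBall (z : ℂ) (z.im / 2)) :=
    (UpperHalfPlane.mdifferentiable_iff.1 hF).mono fun w hw => hR.trans_le (him hw)
  have hle : ‖deriv (F ∘ ofComplex) z‖ ≤ |B| / (z.im / 2) := by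
    refine Complex.norm_deriv_le_of_forall_mem_sphere_norm_le hR
      (hd.diffContOnCl_ball subset_rfl) fun w hw => ?_
    have hw' := him (Metric.sphere_subset_closedBall hw)
    rw [Function.comp_apply, ofComplex_apply_of_im_pos (hR.trans_le hw')]
    refine (hBA _ ?_).trans (le_abs_self B)
    change A ≤ w.im
    linarith [le_abs_self A]
  rw [normalizedDerivOfComplex, norm_mul]
  refine (mul_le_mul_of_nonneg_left hle (norm_nonneg _)).trans ?_
  rw [div_le_iff₀ hε] at hz2
  rw [← mul_div_assoc, div_le_iff₀ hR]
  linarith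

/-- `D E₂ - E₂² / 12`, a modular form of weight `4`. -/
def ramanujanFun (z : ℍ) : ℂ := normalizedDerivOfComplex E2 z - E2 z ^ 2 / 12

/-- The anomaly of `D E₂` under the slash action comes from the weight and from the cocycle of `E₂`;
it equals that of `E₂² / 12`. -/
theorem ramanujanFun_slash (γ : SL(2, ℤ)) : ramanujanFun ∣[(4 : ℤ)] γ = ramanujanFun := by
  funext z
  have hJ := hasDerivAt_denom_zpow (γ : GL (Fin 2) ℝ) (-1) z
  have hE2 : HasDerivAt (E2 ∘ ofComplex) (deriv (E2 ∘ ofComplex) z) z :=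
    (UpperHalfPlane.mdifferentiableAt_iff.mp (E2_mdifferentiable z)).hasDerivAt
  set d := denom (γ : GL (Fin 2) ℝ) z with hd
  have hd0 : d ≠ 0 := denom_ne_zero _ z
  set c : ℂ := (((γ 1 0 : ℤ) : ℝ) : ℂ) with hc
  have hp : (Real.pi : ℂ) ≠ 0 := Complex.ofReal_ne_zero.2 Real.pi_ne_zero
  have hI : Complex.I ^ 2 = -1 := Complex.I_sq
  have hκ : (1 / (2 * riemannZeta 2) : ℂ) = 3 / Real.pi ^ 2 := by
    rw [riemannZeta_two]
    field_simp
    norm_num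
  have h1 : E2 (γ • z) * d ^ (-2 : ℤ) =
      E2 z - 3 / Real.pi ^ 2 * (2 * Real.pi * Complex.I * c / d) := by
    have := congrFun (E2_slash_action γ) z
    rw [ModularForm.SL_slash_apply, hκ] at this
    simpa [D2, hc] using this
  -- `D(E₂ ∣ γ)` is computed twice: by differentiating the transformation law of `E₂` here, and by
  -- the general rule for `D` of a slash in `h3`.
  have h2 : normalizedDerivOfComplex (E2 ∣[(2 : ℤ)] γ) z =
      (2 * Real.pi * Complex.I)⁻¹ * (deriv (E2 ∘ ofComplex) z +
        3 / Real.pi ^ 2 * (2 * Real.pi * Complex.I * c * (c * d ^ (-2 : ℤ)))) := by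
    rw [normalizedDerivOfComplex, E2_slash_action, hκ]
    congr 1
    have h3 := hE2.sub ((hJ.const_mul (2 * Real.pi * Complex.I * c)).const_mul (3 / (Real.pi : ℂ) ^ 2))
    have h4 : ((E2 - (3 / (Real.pi : ℂ) ^ 2) • D2 γ) ∘ ofComplex) =ᶠ[𝓝 (z : ℂ)]
        (E2 ∘ ofComplex) - fun w => 3 / (Real.pi : ℂ) ^ 2 * (2 * Real.pi * Complex.I * c *
          denom (γ : GL (Fin 2) ℝ) w ^ (-1 : ℤ)) := by
      filter_upwards [isOpen_upperHalfPlaneSet.mem_nhds z.im_pos] with w hw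
      simp [D2, ofComplex_apply_of_im_pos hw, hc, div_eq_mul_inv]
    rw [(h3.congr_of_eventuallyEq h4).deriv]
    simp [hc]
  have h3 := congrFun (normalizedDerivOfComplex_SL_slash (k := 2) E2_mdifferentiable (γ := γ)) z
  rw [h2, Pi.sub_apply, ModularForm.SL_slash_apply, ModularForm.SL_slash_apply, h1] at h3
  rw [ModularForm.SL_slash_apply, ramanujanFun, ramanujanFun]
  rw [show ((2 : ℤ) + 2) = 4 by norm_num] at h3
  have hz4 : d ^ (-4 : ℤ) = (d ^ 4)⁻¹ := by rw [zpow_neg]; rfl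
  have hz2 : d ^ (-2 : ℤ) = (d ^ 2)⁻¹ := by rw [zpow_neg]; rfl
  change _ = normalizedDerivOfComplex E2 (γ • z) * d ^ (-4 : ℤ) -
    (2 : ℤ) * (2 * Real.pi * Complex.I)⁻¹ * ((((γ 1 0 : ℤ)) : ℂ) / d) * _ at h3
  change (normalizedDerivOfComplex E2 (γ • z) - E2 (γ • z) ^ 2 / 12) * d ^ (-4 : ℤ) =
    (2 * Real.pi * Complex.I)⁻¹ * deriv (E2 ∘ ofComplex) z - _
  have hcc : ((γ 1 0 : ℤ) : ℂ) = c := by simp [hc]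
  rw [hz2] at h1 h3
  rw [hz4] at h3 ⊢
  rw [hcc] at h3
  have e : (E2 (γ • z) ^ 2) * (d ^ 4)⁻¹ = (E2 (γ • z) * (d ^ 2)⁻¹) ^ 2 := by ring
  rw [h1] at e
  rw [sub_mul, div_mul_eq_mul_div, e]
  push_cast at h3
  field_simp at h3 ⊢
  linear_combination -12 * h3 + (24 * Real.pi * d ^ 3 * E2 z * c -
    72 * Complex.I * c ^ 2 * d ^ 2) * hI

theorem tendsto_ramanujanFun : Tendsto ramanujanFun atImInfty (𝓝 (-1 / 12)) := by
  have h := (isZeroAtImInfty_D E2_mdifferentiable isBoundedAtImInfty_E2).sub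
    ((tendsto_E2.pow 2).div_const 12)
  convert! h using 2
  norm_num

theorem ramanujanFun_mdifferentiable : MDiff ramanujanFun := by
  refine (normalizedDerivOfComplex_mdifferentiable E2_mdifferentiable).sub ?_
  convert! (MDifferentiable.mul mdifferentiable_const (E2_mdifferentiable.mul E2_mdifferentiable) :
    MDiff (fun z ↦ (12⁻¹ : ℂ) * (E2 z * E2 z))) using 2
  simp only [Pi.mul_apply]
  ring

/-- `D E₂ - E₂² / 12` as a modular form. -/
def ramanujanForm : ModularForm 𝒮ℒ 4 where
  toFun := ramanujanFun
  slash_action_eq' := by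
    rintro _ ⟨γ, rfl⟩
    exact ramanujanFun_slash γ
  holo' := ramanujanFun_mdifferentiable
  bdd_at_cusps' {c} hc := by
    rw [OnePoint.isBoundedAt_iff_forall_SL2Z hc]
    intro γ _
    rw [ramanujanFun_slash]
    exact tendsto_ramanujanFun.isBigO_one ℝ

/-- Level one forms of weight `4` are multiples of `E₄`; the limit `-1/12` at `i∞` fixes the
multiple. -/
theorem ramanujanFun_eq : ramanujanFun = fun z => -ModularForm.E₄ z / 12 := by
  obtain ⟨c, hc⟩ := (finrank_eq_one_iff_of_nonzero' ModularForm.E₄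
    (E_ne_zero _ ⟨2, rfl⟩)).mp
    (Module.rank_eq_one_iff_finrank_eq_one.1 ModularForm.levelOne_weight_four_rank_one)
    ramanujanForm
  have h1 : ramanujanFun = fun z => c * ModularForm.E₄ z :=
    (congrArg (DFunLike.coe : ModularForm 𝒮ℒ 4 → ℍ → ℂ) hc).symm
  have h2 : Tendsto ramanujanFun atImInfty (𝓝 (c * 1)) := h1 ▸ tendsto_E₄.const_mul c
  have h3 := tendsto_nhds_unique h2 tendsto_ramanujanFun
  rw [h1]
  funext z
  linear_combination h3 * ModularForm.E₄ z

theorem D_E2 : normalizedDerivOfComplex E2 =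
    fun z => E2 z ^ 2 / 12 - ModularForm.E₄ z / 12 := by
  funext z
  have := congrFun ramanujanFun_eq z
  simp only [ramanujanFun] at this
  linear_combination this

end Ramanujan

/-! ### Invariance of the brackets -/

section Algebra

variable {R : Type*} [CommRing R] [Algebra ℂ R]

theorem zagierBracket_eq_sum (der : ℤ → R → R) (Φ : R) (k l : ℤ) (n : ℕ) (f g : R) :
    zagierBracket der Φ k l n f g = ∑ rs ∈ Finset.HasAntidiagonal.antidiagonal n,
      ((-1) ^ rs.1 * ((ascPochhammer ℂ rs.2).eval ((k : ℂ) + rs.1) / (rs.2 ! : ℂ)) *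
        ((ascPochhammer ℂ rs.1).eval ((l : ℂ) + rs.2) / (rs.1 ! : ℂ))) •
      (zagierSeq der Φ k f rs.1 * zagierSeq der Φ l g rs.2) := by
  refine Finset.sum_congr rfl fun ⟨r, s⟩ hrs => ?_
  obtain rfl : r + s = n := Finset.HasAntidiagonal.mem_antidiagonal.1 hrs
  have h1 := choose_mul_factorial k r s
  have h2 := choose_mul_factorial l s r
  rw [add_comm s r] at h2
  have h3 : (r ! : ℂ) ≠ 0 := by exact_mod_cast r.factorial_ne_zero
  have h4 : (s ! : ℂ) ≠ 0 := by exact_mod_cast s.factorial_ne_zero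
  simp only
  rw [← h1, ← h2, mul_div_cancel_right₀ _ h3, mul_div_cancel_right₀ _ h4]
  push_cast
  rfl

/-- The coefficients in the expansion of Zagier's sequence for a conjugated derivation. -/
def shiftCoeff (k : ℤ) (a j : ℕ) : ℂ :=
  ((a + j)! : ℂ) / ((a ! : ℂ) * (j ! : ℂ)) * (ascPochhammer ℂ j).eval ((k : ℂ) + a)

theorem shiftCoeff_zero_right (k : ℤ) (a : ℕ) : shiftCoeff k a 0 = 1 := by
  have h : (a ! : ℂ) ≠ 0 := by exact_mod_cast a.factorial_ne_zero
  simp [shiftCoeff, h]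

theorem shiftCoeff_zero_left (k : ℤ) (j : ℕ) :
    shiftCoeff k 0 (j + 1) = (k + j) * shiftCoeff k 0 j := by
  have h (j : ℕ) : (j ! : ℂ) ≠ 0 := by exact_mod_cast j.factorial_ne_zero
  simp [shiftCoeff, h, ascPochhammer_succ_eval, mul_comm]

theorem shiftCoeff_succ_succ (k : ℤ) (a j : ℕ) : shiftCoeff k (a + 1) (j + 1) =
    shiftCoeff k a (j + 1) + (k + 2 * a + j + 2) * shiftCoeff k (a + 1) j := by
  have h (j : ℕ) : (j ! : ℂ) ≠ 0 := by exact_mod_cast j.factorial_ne_zero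
  have h' (j : ℕ) : (j : ℂ) + 1 ≠ 0 := by exact_mod_cast j.succ_ne_zero
  have e1 : (ascPochhammer ℂ (j + 1)).eval ((k : ℂ) + a) =
      (k + a) * (ascPochhammer ℂ j).eval ((k : ℂ) + (a + 1 : ℕ)) := by
    rw [ascPochhammer_succ_left, Polynomial.eval_mul, Polynomial.eval_X, Polynomial.eval_comp]
    simp [add_assoc]
  rw [shiftCoeff, shiftCoeff, shiftCoeff, e1, ascPochhammer_succ_eval,
    show a + 1 + (j + 1) = (a + j + 1) + 1 by ring, show a + 1 + j = a + j + 1 by ring,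
    show a + (j + 1) = a + j + 1 by ring]
  simp only [Nat.factorial_succ]
  have h1 := h a
  have h2 := h j
  have h3 := h' a
  have h4 := h' j
  push_cast
  field_simp
  ring

theorem succ_mul_shiftCoeff (k : ℤ) (a j : ℕ) : (j + 1) * shiftCoeff k a (j + 1) =
    (a + j + 1) * (k + a + j) * shiftCoeff k a j := by
  have h (j : ℕ) : (j ! : ℂ) ≠ 0 := by exact_mod_cast j.factorial_ne_zero
  have h' : (j : ℂ) + 1 ≠ 0 := by exact_mod_cast j.succ_ne_zero
  rw [shiftCoeff, shiftCoeff, ascPochhammer_succ_eval, show a + (j + 1) = a + j + 1 by ring]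
  simp only [Nat.factorial_succ]
  have h1 := h a
  have h2 := h j
  push_cast
  field_simp

/-- The effect of `D + (k + 2r) q` on the expansion, when `D (q^j)` contributes `-j q^{j+1}`; the
`Φ`-part is left to `sum_smul_shiftCoeff`. -/
theorem sum_shiftCoeff_succ (k : ℤ) (r : ℕ) (q : R) (u : ℕ → R) :
    ∑ aj ∈ Finset.HasAntidiagonal.antidiagonal (r + 1), shiftCoeff k aj.1 aj.2 • (q ^ aj.2 * u aj.1) =
      ∑ aj ∈ Finset.HasAntidiagonal.antidiagonal r,
        (shiftCoeff k aj.1 aj.2 • (q ^ aj.2 * u (aj.1 + 1)) +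
        ((k + 2 * r - aj.2) * shiftCoeff k aj.1 aj.2) • (q ^ (aj.2 + 1) * u aj.1)) := by
  rw [Finset.sum_add_distrib]
  cases r with
  | zero =>
    simp [Finset.Nat.antidiagonal_succ, shiftCoeff_zero_right, shiftCoeff_zero_left, add_comm]
  | succ r =>
    rw [Finset.Nat.sum_antidiagonal_succ, Finset.Nat.sum_antidiagonal_succ',
      Finset.Nat.sum_antidiagonal_succ' (n := r),
      Finset.Nat.sum_antidiagonal_succ (n := r)
        (f := fun aj => ((k + 2 * (r + 1 : ℕ) - aj.2) * shiftCoeff k aj.1 aj.2) •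
          (q ^ (aj.2 + 1) * u aj.1))]
    have h : ∑ aj ∈ Finset.HasAntidiagonal.antidiagonal r,
        shiftCoeff k (aj.1 + 1) (aj.2 + 1) • (q ^ (aj.2 + 1) * u (aj.1 + 1)) =
        ∑ aj ∈ Finset.HasAntidiagonal.antidiagonal r,
          shiftCoeff k aj.1 (aj.2 + 1) • (q ^ (aj.2 + 1) * u (aj.1 + 1)) +
        ∑ aj ∈ Finset.HasAntidiagonal.antidiagonal r,
          ((k + 2 * (r + 1 : ℕ) - aj.2) * shiftCoeff k (aj.1 + 1) aj.2) •
            (q ^ (aj.2 + 1) * u (aj.1 + 1)) := by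
      rw [← Finset.sum_add_distrib]
      refine Finset.sum_congr rfl fun ⟨a, j⟩ haj => ?_
      obtain rfl : a + j = r := Finset.HasAntidiagonal.mem_antidiagonal.1 haj
      rw [shiftCoeff_succ_succ, ← add_smul]
      congr 2
      push_cast
      ring
    have h0 : shiftCoeff k 0 (r + 1 + 1) =
        (k + 2 * (r + 1 : ℕ) - (r + 1 : ℕ)) * shiftCoeff k 0 (r + 1) := by
      rw [shiftCoeff_zero_left]
      ring
    simp only [h, h0, shiftCoeff_zero_right]
    abel

/-- The terms `-j Φ q^{j-1}` of `D (q^j)` add up to the negative of Zagier's correction `(r + 1)(r +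
k) Φ f_r`, so `Φ` disappears from the expansion. -/
theorem sum_smul_shiftCoeff (k : ℤ) (r : ℕ) (q Φ : R) (u : ℕ → R) :
    ∑ aj ∈ Finset.HasAntidiagonal.antidiagonal (r + 1),
      ((aj.2 : ℂ) * shiftCoeff k aj.1 aj.2) • (q ^ (aj.2 - 1) * (Φ * u aj.1)) =
    (((r : ℂ) + 1) * (r + k)) • (Φ * ∑ aj ∈ Finset.HasAntidiagonal.antidiagonal r,
      shiftCoeff k aj.1 aj.2 • (q ^ aj.2 * u aj.1)) := by
  rw [Finset.Nat.sum_antidiagonal_succ', Finset.mul_sum, Finset.smul_sum]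
  simp only [Nat.cast_zero, zero_mul, zero_smul, zero_add, Nat.add_sub_cancel]
  refine Finset.sum_congr rfl fun ⟨a, j⟩ haj => ?_
  obtain rfl : a + j = r := Finset.HasAntidiagonal.mem_antidiagonal.1 haj
  simp only [Nat.cast_add, Nat.cast_one]
  rw [succ_mul_shiftCoeff, mul_smul_comm, smul_smul, mul_left_comm Φ]
  congr 1
  ring
theorem ascPochhammer_eval_add (x : ℂ) (j s : ℕ) : (ascPochhammer ℂ (j + s)).eval x =
    (ascPochhammer ℂ j).eval x * (ascPochhammer ℂ s).eval (x + j) := by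
  rw [← ascPochhammer_mul, Polynomial.eval_mul, Polynomial.eval_comp]
  simp

/-- The generating polynomial of a sequence of weight `k`, normalised for the `n`-th bracket. -/
def bracketSeries (k : ℤ) (n : ℕ) (u : ℕ → R) : PowerSeries R := PowerSeries.mk fun a =>
  ((ascPochhammer ℂ (n - a)).eval ((k : ℂ) + a) / (a ! : ℂ)) • u a

theorem coeff_bracketSeries_mul (k l : ℤ) (n : ℕ) (u v : ℕ → R) :
    PowerSeries.coeff n (PowerSeries.rescale (-1) (bracketSeries k n u) * bracketSeries l n v) =
      ∑ rs ∈ Finset.HasAntidiagonal.antidiagonal n,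
      ((-1) ^ rs.1 * ((ascPochhammer ℂ rs.2).eval ((k : ℂ) + rs.1) / (rs.2 ! : ℂ)) *
        ((ascPochhammer ℂ rs.1).eval ((l : ℂ) + rs.2) / (rs.1 ! : ℂ))) •
      (u rs.1 * v rs.2) := by
  rw [PowerSeries.coeff_mul]
  refine Finset.sum_congr rfl fun ⟨r, s⟩ hrs => ?_
  obtain rfl : r + s = n := Finset.HasAntidiagonal.mem_antidiagonal.1 hrs
  simp only [PowerSeries.coeff_rescale, bracketSeries, PowerSeries.coeff_mk, Nat.add_sub_cancel,
    Nat.add_sub_cancel_left]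
  simp only [Algebra.smul_def, map_mul, map_pow, map_neg, map_one, div_eq_mul_inv]
  ring

/-- Conjugated sequences have the same brackets. -/
theorem sum_shift_eq (k l : ℤ) (n : ℕ) {f g u v : ℕ → R} {q : R}
    (hf : ∀ r, f r = ∑ aj ∈ Finset.HasAntidiagonal.antidiagonal r,
      shiftCoeff k aj.1 aj.2 • (q ^ aj.2 * u aj.1))
    (hg : ∀ r, g r = ∑ aj ∈ Finset.HasAntidiagonal.antidiagonal r,
      shiftCoeff l aj.1 aj.2 • (q ^ aj.2 * v aj.1)) :
    PowerSeries.coeff n (PowerSeries.rescale (-1) (bracketSeries k n f) * bracketSeries l n g) =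
    PowerSeries.coeff n
      (PowerSeries.rescale (-1) (bracketSeries k n u) * bracketSeries l n v) := by
  let _ : Algebra ℚ R := RestrictScalars.algebra ℚ ℂ R
  -- Up to degree `n` the expansion says that the generating series is multiplied by `exp(q t)`. The
  -- bound `r ≤ n` allows the splitting `(k + a)_{n-a} = (k + a)_j (k + a + j)_{n-a-j}`.
  have key (k : ℤ) {f u : ℕ → R} (hf : ∀ r, f r = ∑ aj ∈ Finset.HasAntidiagonal.antidiagonal r,
      shiftCoeff k aj.1 aj.2 • (q ^ aj.2 * u aj.1)) (r : ℕ) (hr : r ≤ n) :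
      PowerSeries.coeff r (bracketSeries k n f) = PowerSeries.coeff r
        (bracketSeries k n u * PowerSeries.rescale q (PowerSeries.exp R)) := by
    rw [PowerSeries.coeff_mul, bracketSeries, PowerSeries.coeff_mk, hf, Finset.smul_sum]
    refine Finset.sum_congr rfl fun ⟨a, j⟩ haj => ?_
    obtain rfl : a + j = r := Finset.HasAntidiagonal.mem_antidiagonal.1 haj
    have h (j : ℕ) : (j ! : ℂ) ≠ 0 := by exact_mod_cast j.factorial_ne_zero
    have e : (algebraMap ℚ R) (1 / (j ! : ℚ)) = algebraMap ℂ R (1 / (j ! : ℂ)) := by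
      have : algebraMap ℚ R = (algebraMap ℂ R).comp (algebraMap ℚ ℂ) := RingHom.ext_rat _ _
      rw [this]
      simp
    simp only [PowerSeries.coeff_rescale, PowerSeries.coeff_exp, bracketSeries,
      PowerSeries.coeff_mk, e]
    have e1 : (ascPochhammer ℂ (n - a)).eval ((k : ℂ) + a) =
        (ascPochhammer ℂ j).eval ((k : ℂ) + a) *
          (ascPochhammer ℂ (n - (a + j))).eval ((k : ℂ) + (a + j : ℕ)) := by
      rw [show n - a = j + (n - (a + j)) by omega, ascPochhammer_eval_add]
      push_cast
      rw [add_assoc]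
    rw [e1, shiftCoeff, smul_smul, mul_comm (q ^ j) (algebraMap ℂ R _), ← Algebra.smul_def,
      smul_mul_smul_comm, mul_comm (q ^ j)]
    congr 1
    have h1 := h a
    have h2 := h j
    have h3 := h (a + j)
    field_simp
  -- The sign `(-1)^r` of the bracket is the substitution `t ↦ -t`, so the two exponentials are
  -- inverse to each other.
  have h1 : PowerSeries.rescale (-1) (PowerSeries.rescale q (PowerSeries.exp R)) *
      PowerSeries.rescale q (PowerSeries.exp R) = 1 := by
    rw [PowerSeries.rescale_rescale, PowerSeries.exp_mul_exp_eq_exp_add]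
    simp
  have h2 : PowerSeries.rescale (-1) (bracketSeries k n u) * bracketSeries l n v =
      PowerSeries.rescale (-1) (bracketSeries k n u * PowerSeries.rescale q (PowerSeries.exp R)) *
        (bracketSeries l n v * PowerSeries.rescale q (PowerSeries.exp R)) := by
    rw [map_mul, mul_mul_mul_comm, h1, mul_one]
  rw [h2, PowerSeries.coeff_mul, PowerSeries.coeff_mul]
  refine Finset.sum_congr rfl fun ⟨r, s⟩ hrs => ?_
  have hrs : r + s = n := Finset.HasAntidiagonal.mem_antidiagonal.1 hrs
  rw [PowerSeries.coeff_rescale, PowerSeries.coeff_rescale, key k hf r (by omega),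
    key l hg s (by omega)]

end Algebra

/-! ### The Serre derivative -/

section Serre

open UpperHalfPlane Derivative EisensteinSeries

theorem mdiff_sum {ι : Type*} (s : Finset ι) {f : ι → ℍ → ℂ} (hf : ∀ i, MDiff (f i)) :
    MDiff (∑ i ∈ s, f i) := by
  classical
  induction s using Finset.induction_on with
  | empty => exact mdifferentiable_const
  | insert i s hi ih => rw [Finset.sum_insert hi]; exact (hf i).add ih

theorem D_sum {ι : Type*} (s : Finset ι) {f : ι → ℍ → ℂ} (hf : ∀ i, MDiff (f i)) :
    normalizedDerivOfComplex (∑ i ∈ s, f i) = ∑ i ∈ s, normalizedDerivOfComplex (f i) := by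
  classical
  induction s using Finset.induction_on with
  | empty => exact normalizedDerivOfComplex_const 0
  | insert i s hi ih =>
    rw [Finset.sum_insert hi, Finset.sum_insert hi,
      normalizedDerivOfComplex_add _ _ (hf i) (mdiff_sum s hf), ih]

theorem D_iterate_mdiff {F : ℍ → ℂ} (hF : MDiff F) (r : ℕ) :
    MDiff (normalizedDerivOfComplex^[r] F) := by
  induction r with
  | zero => exact hF
  | succ r ih =>
    rw [Function.iterate_succ_apply']
    exact normalizedDerivOfComplex_mdifferentiable ih

/-- `-E₂ / 12`, the connection coefficient of the Serre derivative. -/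
def serreShift : ℍ → ℂ := (-(1 / 12) : ℂ) • E2

theorem serreShift_mdiff : MDiff serreShift := E2_mdifferentiable.const_smul _

theorem serreDerivative_eq_add (w : ℂ) (f : ℍ → ℂ) :
    serreDerivative w f = normalizedDerivOfComplex f + w • (serreShift * f) := by
  funext z
  simp [serreShift]
  ring

/-- Ramanujan's identity as a Riccati equation for `q`; it explains the value `Φ = -E₄ / 144`. -/
theorem D_serreShift : normalizedDerivOfComplex serreShift =
    -(serreShift ^ 2 + fun z => -(ModularForm.E₄ z) / 144) := by
  rw [serreShift, normalizedDerivOfComplex_smul _ _ E2_mdifferentiable, D_E2]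
  funext z
  simp
  ring

theorem mdiff_pow {f : ℍ → ℂ} (hf : MDiff f) (n : ℕ) : MDiff (f ^ n) := by
  induction n with
  | zero => rw [pow_zero]; exact mdifferentiable_const
  | succ n ih => rw [pow_succ]; exact ih.mul hf

/-- The expansion of Zagier's sequence for the Serre derivative in ordinary derivatives. -/
theorem zagierSeq_serreDerivative (k : ℤ) {F : ℍ → ℂ} (hF : MDiff F) (r : ℕ) :
    zagierSeq (fun w : ℤ => serreDerivative (w : ℂ)) (fun z : ℍ => -(ModularForm.E₄ z) / 144) k F r =
      ∑ aj ∈ Finset.HasAntidiagonal.antidiagonal r, shiftCoeff k aj.1 aj.2 •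
        (serreShift ^ aj.2 * normalizedDerivOfComplex^[aj.1] F) := by
  set Φ : ℍ → ℂ := fun z : ℍ => -(ModularForm.E₄ z) / 144 with hΦ
  set q := serreShift
  set u : ℕ → ℍ → ℂ := fun a => normalizedDerivOfComplex^[a] F with hu
  have hterm (a j : ℕ) : MDiff (q ^ j * u a) := (mdiff_pow serreShift_mdiff j).mul (D_iterate_mdiff hF a)
  have hD (a j : ℕ) : normalizedDerivOfComplex (q ^ j * u a) =
      q ^ j * u (a + 1) - (j : ℂ) • (q ^ (j + 1) * u a) - (j : ℂ) • (q ^ (j - 1) * (Φ * u a)) := by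
    rw [normalizedDerivOfComplex_mul _ _ (mdiff_pow serreShift_mdiff j) (D_iterate_mdiff hF a),
      normalizedDerivOfComplex_pow _ _ serreShift_mdiff, D_serreShift, hu]
    simp only [Function.iterate_succ_apply']
    rcases j with - | j
    · simp
    · simp only [Algebra.smul_def, map_natCast, Nat.add_sub_cancel]
      ring
  change _ = ∑ aj ∈ Finset.HasAntidiagonal.antidiagonal r,
    shiftCoeff k aj.1 aj.2 • (q ^ aj.2 * u aj.1)
  induction r using Nat.twoStepInduction with
  | zero => simp [zagierSeq, shiftCoeff_zero_right, u]
  | one =>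
    rw [zagierSeq, serreDerivative_eq_add, sum_shiftCoeff_succ k 0 q u]
    simp [shiftCoeff_zero_right, u, q]
  | more r h0 h1 =>
    rw [zagierSeq, h1, h0, serreDerivative_eq_add, D_sum _ fun aj => (hterm _ _).const_smul _,
      sum_shiftCoeff_succ k (r + 1) q u, Int.cast_mul]
    have h := sum_smul_shiftCoeff k r q Φ u
    push_cast at h ⊢
    rw [← h, Finset.mul_sum, Finset.smul_sum, ← Finset.sum_add_distrib, ← Finset.sum_add_distrib]
    refine Finset.sum_congr rfl fun ⟨a, j⟩ _ => ?_
    simp only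
    rw [normalizedDerivOfComplex_smul _ _ (hterm a j), hD]
    simp only [Algebra.smul_def, map_add, map_sub, map_mul]
    ring

theorem ddz_iterate {F : ℍ → ℂ} (hF : MDiff F) (r : ℕ) :
    normalizedDerivOfComplex^[r] F = (2 * (Real.pi : ℂ) * Complex.I)⁻¹ ^ r • ddz^[r] F := by
  induction r with
  | zero => simp
  | succ r ih =>
    rw [Function.iterate_succ_apply', ih, normalizedDerivOfComplex_smul _ _ (ddz_iterate_mdiff hF r),
      Function.iterate_succ_apply', pow_succ, mul_smul]
    rfl

theorem zagierBracket_serreDerivative (k l : ℤ) {F G : ℍ → ℂ} (hF : MDiff F) (hG : MDiff G)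
    (n : ℕ) :
    zagierBracket (fun w : ℤ => serreDerivative (w : ℂ)) (fun z : ℍ => -(ModularForm.E₄ z) / 144)
      k l n F G = (2 * (Real.pi : ℂ) * Complex.I)⁻¹ ^ n • rankinCohen k l n F G := by
  rw [zagierBracket_eq_sum, ← coeff_bracketSeries_mul,
    sum_shift_eq k l n (q := serreShift) (u := fun a => normalizedDerivOfComplex^[a] F)
      (v := fun a => normalizedDerivOfComplex^[a] G) (zagierSeq_serreDerivative k hF)
      (zagierSeq_serreDerivative l hG),
    coeff_bracketSeries_mul, rankinCohen, Finset.smul_sum]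
  refine Finset.sum_congr rfl fun ⟨r, s⟩ hrs => ?_
  obtain rfl : r + s = n := Finset.HasAntidiagonal.mem_antidiagonal.1 hrs
  have h1 := choose_mul_factorial k r s
  have h2 := choose_mul_factorial l s r
  rw [add_comm s r] at h2
  have h3 : (r ! : ℂ) ≠ 0 := by exact_mod_cast r.factorial_ne_zero
  have h4 : (s ! : ℂ) ≠ 0 := by exact_mod_cast s.factorial_ne_zero
  simp only
  rw [← h1, ← h2, mul_div_cancel_right₀ _ h3, mul_div_cancel_right₀ _ h4, ddz_iterate hF,
    ddz_iterate hG, smul_mul_smul_comm, ← pow_add, smul_comm]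
  push_cast
  rfl

end Serre

end ZagierFedosov

end

theorem mainTheorem4 :
    -- Fedosov's construction and the explicit star product, for every smooth `ν`
    (∀ (ν : ℝ → ℝ) (hν : ContDiff ℝ ∞ ν),
      (IsTorsionFree (zagierConnection ν hν) ∧ IsSymplectic (zagierConnection ν hν) ∧
        IsFlat (zagierConnection ν hν)) ∧
      (∃! r : WeylForm, IsFedosovForm (zagierConnection ν hν) r) ∧
      (∀ a : Weyl, fedosovDform (zagierConnection ν hν) (fedosovForm (zagierConnection ν hν))
        (fedosovD (zagierConnection ν hν) (fedosovForm (zagierConnection ν hν)) a) = 0) ∧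
      (∀ f : PowerSeries Fn, ∃! a : Weyl, IsFlatLift (zagierConnection ν hν) f a) ∧
      (∀ (f : PowerSeries Fn) (N m n : ℕ),
        weylCoeff (flatLift (zagierConnection ν hν) f) N m n =
          ((-1) ^ n / ((2 : ℂ) ^ n * (m ! : ℂ) * (n ! : ℂ))) •
            (x₂ ^ m * x₂inv ^ n *
              rcB (-(ofX₁ ν hν * x₂inv ^ 2)) m (poch m n (PowerSeries.coeff N f)))) ∧
      (∀ f g : PowerSeries Fn,
        fedosovStar (zagierConnection ν hν) f g =
          rcSeries (-(ofX₁ ν hν * x₂inv ^ 2)) (Complex.I / 4) f g) ∧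
      -- on functions of weights `k`, `l` it is Zagier's deformation with `Φ = ν / (2 x₂²)`
      (∀ (k l : ℤ) (f g : Fn), Y f = ((k : ℂ) / 2) • f → Y g = ((l : ℂ) / 2) • g →
        fedosovStar (zagierConnection ν hν) (PowerSeries.C f) (PowerSeries.C g) =
          PowerSeries.mk fun n => (Complex.I / 4) ^ n •
            zagierBracket (fun _ => X) ((1 / 2 : ℂ) • (ofX₁ ν hν * x₂inv ^ 2)) k l n f g)) ∧
    -- modular forms, restricted to horizontal lines: the Rankin–Cohen brackets (`ν = 0`)
    (∀ (𝒢 : Subgroup (GL (Fin 2) ℝ)) (k l : ℤ) (F : ModularForm 𝒢 k) (G : ModularForm 𝒢 l)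
      (c : ℝ) (hc : 0 < c) (n : ℕ) (p : M),
      (PowerSeries.coeff n
        (fedosovStar (zagierConnection (fun _ => 0) contDiff_const)
          (PowerSeries.C (horizontalLift c hc k F F.holo'))
          (PowerSeries.C (horizontalLift c hc l G G.holo')))).1 p =
        (Complex.I / 4) ^ n * ((p.1.2 ^ (-((k + l + 2 * n : ℤ) : ℝ) / 2) : ℝ) : ℂ) *
          rankinCohen k l n F G (horizontal c hc p.1.1)) ∧
    -- modular forms of level one with the Serre derivative and `Φ = -E₄ / 144`
    (∀ (k l : ℤ) (F : ModularForm 𝒮ℒ k) (G : ModularForm 𝒮ℒ l) (n : ℕ),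
      zagierBracket (fun w : ℤ => Derivative.serreDerivative (w : ℂ))
          (fun z : ℍ => -(ModularForm.E₄ z) / 144) k l n (F : ℍ → ℂ) (G : ℍ → ℂ) =
        (2 * (Real.pi : ℂ) * Complex.I)⁻¹ ^ n • rankinCohen k l n F G) := by
  refine ⟨fun ν hν => ⟨⟨isTorsionFree_zagierConnection ν hν, isSymplectic_zagierConnection ν hν,
    isFlat_zagierConnection ν hν⟩, existsUnique_isFedosovForm ν hν, fedosovDform_fedosovD ν hν,
    existsUnique_isFlatLift ν hν, weylCoeff_flatLift ν hν, fedosovStar_eq ν hν,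
    fun k l f g hf hg => fedosovStar_C_eq_zagierBracket ν hν hf hg⟩,
    fun _ k l F G c hc n p =>
      coeff_fedosovStar_horizontalLift c hc k l F.holo' G.holo' n p,
    fun k l F G n => zagierBracket_serreDerivative k l F.holo' G.holo' n⟩
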